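/- Let $\mathbb F\in\{\mathbb R,\mathbb C\}$, put $\varphi=1$ if $\mathbb F=\mathbb R$ and $\varphi=2$ if $\mathbb F=\mathbb C$, and let $M^*$ denote the conjugate transpose of $M$. Let $A,B\in\mathbb F^{n\times n}$ be such that the pencil $A-\lambda B$ is singular of normal rank $\max_{\zeta\in\mathbb F}\operatorname{rank}(A-\zeta B)=n-k$, $k\ge 1$, and let $\lambda_i\in\mathbb F$ be a finite simple eigenvalue of it, i.e. a simple root of $\det R(\lambda)$, where $R(\lambda)$ is the regular part in the Kronecker canonical form of $A-\lambda B$. Let $\mathcal M_{\rm RS}$ be the minimal reducing subspace of $A-\lambda B$, i.e. the intersection of all subspaces $\mathcal M\subseteq\mathbb F^n$ with $\dim(A\mathcal M+B\mathcal M)=\dim\mathcal M-k$, and let $\mathcal L_{\rm RS}$ be the intersection of all subspaces $\mathcal L\subseteq\mathbb F^n$ with $\dim(A^*\mathcal L+B^*\mathcal L)=\dim\mathcal L-k$. Let $X=[X_1\ x]$ and $Y=[Y_1\ y]$ be $n\times(k+1)$ matrices over $\mathbb F$ with orthonormal columns such that the columns of $X$ form a basis of $\ker(A-\lambda_iB)$,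 those of $X_1$ a basis of $\ker(A-\lambda_iB)\cap\mathcal M_{\rm RS}$, those of $Y$ a basis of $\ker((A-\lambda_iB)^*)$ and those of $Y_1$ a basis of $\ker((A-\lambda_iB)^*)\cap\mathcal L_{\rm RS}$. For vectors $z,w$ put $\gamma(w,z)=|w^*Bz|\,(1+|\lambda_i|^2)^{-1/2}$, and let $\gamma(\lambda_i)=\gamma(y,x)$. Let $U,V$ be independent random matrices, both uniformly distributed on the Stiefel manifold $\mathbb V_k^n(\mathbb F)=\{Q\in\mathbb F^{n\times k}: Q^*Q=I\}$. Let $\tau\in\mathbb F$ be nonzero and let $D_A,D_B\in\mathbb F^{k\times k}$ be diagonal matrices (fixed, or random with an arbitrary dependence on $U,V$) such that, almost surely, $D_A-\lambda_iD_B$ is nonsingular. Consider the modified pencil $$\widetilde A-\lambda\widetilde B=A-\lambda B+\tau\,(UD_AV^*-\lambda\,UD_BV^*),$$ and let $x_i,y_i$ be right and left eigenvectors of it for $\lambda_i$, i.e. $\|x_i\|_2=\|y_i\|_2=1$, $(\widetilde A-\lambda_i\widetilde B)x_i=0$ and $y_i^*(\widetilde A-\lambda_i\widetilde B)=0$ almost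 surely. Then, almost surely, $\widetilde A-\lambda\widetilde B$ is regular (its determinant is not identically zero), $\ker(\widetilde A-\lambda_i\widetilde B)$ and $\ker((\widetilde A-\lambda_i\widetilde B)^*)$ are one-dimensional, $V^*x_i=0$, $U^*y_i=0$, and there are unique $a,b\in\mathbb F^k$ and $\alpha,\beta\in\mathbb F$ such that $$x_i=[X_1\ x]\begin{bmatrix}a\\ \alpha\end{bmatrix},\qquad y_i=[Y_1\ y]\begin{bmatrix}b\\ \beta\end{bmatrix}.$$ Moreover, $|\alpha|$ and $|\beta|$ are independent random variables, $$|\alpha|^2\sim\mathrm{Beta}\Big(\frac{\varphi}{2},\frac{\varphi k}{2}\Big),\qquad |\beta|^2\sim\mathrm{Beta}\Big(\frac{\varphi}{2},\frac{\varphi k}{2}\Big),$$ and, almost surely, $\gamma_i:=\gamma(y_i,x_i)$ satisfies $\gamma_i=|\alpha|\,|\beta|\,\gamma(\lambda_i)$. -/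

import Mathlib

/-! ### Matrix pencils -/

/-- The pencil `A - X B` as a matrix of polynomials. -/
noncomputable def pencil {K : Type*} [Field K] {ι : Type*} (A B : Matrix ι ι K) :
    Matrix ι ι (Polynomial K) :=
  A.map Polynomial.C - (Polynomial.X : Polynomial K) • B.map Polynomial.C

/-- The normal rank `max_ζ rank (A - ζ B)`; the ranks are bounded by `n`, so the supremum is
a maximum. -/
noncomputable def nrank {K : Type*} [Field K] {n : ℕ} (A B : Matrix (Fin n) (Fin n) K) : ℕ :=
  ⨆ ζ : K, (A - ζ • B).rank

/-- The `j × (j+1)` Kronecker block `[0 I_j] - X [I_j 0]`. -/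
noncomputable def kroneckerBlock (K : Type*) [Field K] (j : ℕ) :
    Matrix (Fin j) (Fin (j + 1)) (Polynomial K) :=
  fun r c => if c = r.succ then 1 else if c = r.castSucc then -Polynomial.X else 0

/-- The singular part of the Kronecker form, `diag (L_{m_1}, …, L_{m_d}, L_{l_1}ᵀ, …, L_{l_d}ᵀ)`. -/
noncomputable def singularPart (K : Type*) [Field K] {d : ℕ} (m l : Fin d → ℕ) :
    Matrix ((Σ i, Fin (m i)) ⊕ (Σ i, Fin (l i + 1)))
      ((Σ i, Fin (m i + 1)) ⊕ (Σ i, Fin (l i))) (Polynomial K) :=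
  Matrix.fromBlocks (Matrix.blockDiagonal' fun i => kroneckerBlock K (m i)) 0
    0 (Matrix.blockDiagonal' fun i => (kroneckerBlock K (l i)).transpose)

/-- The regular part of the Kronecker form, `diag (J - X I, I - X N)`. -/
noncomputable def regularPart {K : Type*} [Field K] {r s : ℕ}
    (J : Matrix (Fin r) (Fin r) K) (N : Matrix (Fin s) (Fin s) K) :
    Matrix (Fin r ⊕ Fin s) (Fin r ⊕ Fin s) (Polynomial K) :=
  Matrix.fromBlocks (pencil J 1) 0 0 (pencil 1 N)

/-- `lam` is a finite simple eigenvalue of the pencil `A - X B`: in a Kronecker decomposition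
`P (A - X B) Q = diag (R, S)` with invertible constant matrices `P`, `Q`, regular part `R` and
singular part `S`, the number `lam` is a simple root of `det R`. The matrices `J` and `N` (nilpotent)
need not be in Jordan form, so that the decomposition exists over every field; `det R` does not
depend on the decomposition, up to a nonzero constant. The equivalences `er`, `ec` only number the
rows and the columns. -/
def IsSimpleEigenvalue {K : Type*} [Field K] {n : ℕ} (A B : Matrix (Fin n) (Fin n) K)
    (lam : K) : Prop :=
  ∃ (r s d : ℕ) (m l : Fin d → ℕ) (J : Matrix (Fin r) (Fin r) K) (N : Matrix (Fin s) (Fin s) K)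
    (er : Fin n ≃ (Fin r ⊕ Fin s) ⊕ ((Σ i, Fin (m i)) ⊕ (Σ i, Fin (l i + 1))))
    (ec : Fin n ≃ (Fin r ⊕ Fin s) ⊕ ((Σ i, Fin (m i + 1)) ⊕ (Σ i, Fin (l i))))
    (P Q : Matrix (Fin n) (Fin n) K),
    IsUnit P ∧ IsUnit Q ∧ IsNilpotent N ∧
    P.map Polynomial.C * pencil A B * Q.map Polynomial.C =
      (Matrix.fromBlocks (regularPart J N) 0 0 (singularPart K m l)).submatrix er ec ∧
    (regularPart J N).det.rootMultiplicity lam = 1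

/-! ### Reducing subspaces and the distinguished bases -/

/-- `M` is a (right) reducing subspace of the pencil `A - X B` of normal rank `n - k`:
`dim (A M + B M) = dim M - k`. -/
def IsReducing {𝕜 : Type*} [RCLike 𝕜] {n : ℕ} (k : ℕ) (A B : Matrix (Fin n) (Fin n) 𝕜)
    (M : Submodule 𝕜 (EuclideanSpace 𝕜 (Fin n))) : Prop :=
  Module.finrank 𝕜 (M.map (Matrix.toEuclideanLin A) ⊔ M.map (Matrix.toEuclideanLin B) :
    Submodule 𝕜 (EuclideanSpace 𝕜 (Fin n))) + k = Module.finrank 𝕜 M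

/-- The minimal reducing subspace: the intersection of all reducing subspaces. -/
def minReducing {𝕜 : Type*} [RCLike 𝕜] {n : ℕ} (k : ℕ) (A B : Matrix (Fin n) (Fin n) 𝕜) :
    Submodule 𝕜 (EuclideanSpace 𝕜 (Fin n)) :=
  sInf {M | IsReducing k A B M}

/-- The null space of `A - lam B`. -/
noncomputable def pencilKer {𝕜 : Type*} [RCLike 𝕜] {n : ℕ} (A B : Matrix (Fin n) (Fin n) 𝕜)
    (lam : 𝕜) : Submodule 𝕜 (EuclideanSpace 𝕜 (Fin n)) :=
  LinearMap.ker (Matrix.toEuclideanLin (A - lam • B))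

/-- `X = [X₁ x]` has orthonormal columns, `X` is a basis of `ker (A - lam B)` and `X₁` (the first
`k` columns) is a basis of the intersection of this kernel with the minimal reducing subspace.
The distinguished eigenvector `x` is the last column. For left eigenvectors, this is used
with `Aᴴ`, `Bᴴ` and the conjugate of `lam`. -/
structure IsDistinguishedBasis {𝕜 : Type*} [RCLike 𝕜] {n : ℕ} (k : ℕ)
    (A B : Matrix (Fin n) (Fin n) 𝕜) (lam : 𝕜)
    (X : Fin (k + 1) → EuclideanSpace 𝕜 (Fin n)) : Prop where
  orthonormal : Orthonormal 𝕜 X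
  span_eq : Submodule.span 𝕜 (Set.range X) = pencilKer A B lam
  span_init_eq : Submodule.span 𝕜 (Set.range fun j : Fin k => X j.castSucc) =
    pencilKer A B lam ⊓ minReducing k A B

/-- `|y* B x| (1 + |lam|²)^(-1/2)`, the reciprocal of the absolute condition number. -/
noncomputable def gammaVal {𝕜 : Type*} [RCLike 𝕜] {n : ℕ} (B : Matrix (Fin n) (Fin n) 𝕜)
    (lam : 𝕜) (y x : EuclideanSpace 𝕜 (Fin n)) : ℝ :=
  ‖inner 𝕜 y (Matrix.toEuclideanLin B x)‖ * (Real.sqrt (1 + ‖lam‖ ^ 2))⁻¹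

/-- The rank-completing modification `A + τ U D Vᴴ`, `D = diag (d)`. -/
noncomputable def rankCompleted {𝕜 : Type*} [RCLike 𝕜] {n k : ℕ} (A : Matrix (Fin n) (Fin n) 𝕜)
    (τ : 𝕜) (U V : Matrix (Fin n) (Fin k) 𝕜) (d : Fin k → 𝕜) : Matrix (Fin n) (Fin n) 𝕜 :=
  A + τ • (U * Matrix.diagonal d * V.conjTranspose)

/-! ### The uniform distribution on the Stiefel manifold -/

/-- Matrices over `ℝ` or `ℂ` carry the Borel σ-algebra. -/
instance matrixMeasurableSpace {𝕜 : Type*} [RCLike 𝕜] {n k : ℕ} :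
    MeasurableSpace (Matrix (Fin n) (Fin k) 𝕜) :=
  borel _

instance matrixBorelSpace {𝕜 : Type*} [RCLike 𝕜] {n k : ℕ} :
    BorelSpace (Matrix (Fin n) (Fin k) 𝕜) :=
  ⟨rfl⟩

instance unitaryGroupCompactSpace {𝕜 : Type*} [RCLike 𝕜] {n : ℕ} :
    CompactSpace (Matrix.unitaryGroup (Fin n) 𝕜) := by
  refine isCompact_iff_compactSpace.mp ?_
  have h : IsCompact (Set.univ.pi fun _ => Set.univ.pi fun _ => Metric.closedBall 0 1 :
      Set (Fin n → Fin n → 𝕜)) :=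
    isCompact_univ_pi fun _ => isCompact_univ_pi fun _ => isCompact_closedBall 0 1
  refine IsCompact.of_isClosed_subset (X := Matrix (Fin n) (Fin n) 𝕜) h isClosed_unitary ?_
  intro W hW i _ j _
  simpa using entry_norm_bound_of_unitary hW i j

/-- The matrix `[e_1 … e_k]`, so that `W * firstCols` consists of the first `k` columns of `W`. -/
def firstCols (𝕜 : Type*) [RCLike 𝕜] (n k : ℕ) : Matrix (Fin n) (Fin k) 𝕜 :=
  Matrix.of fun i j => if (i : ℕ) = j then 1 else 0

/-- The uniform distribution on the Stiefel manifold `{Q | Qᴴ Q = 1}` of `n × k` matrices, `k ≤ n`: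
the law of the first `k` columns of a Haar distributed orthogonal or unitary `n × n` matrix. It is
the unique probability measure on the Stiefel manifold that is invariant under `Q ↦ W Q` for all
orthogonal or unitary `W`. -/
noncomputable def stiefelUniform (𝕜 : Type*) [RCLike 𝕜] (n k : ℕ) :
    MeasureTheory.Measure (Matrix (Fin n) (Fin k) 𝕜) :=
  (MeasureTheory.Measure.haarMeasure
    (⊤ : TopologicalSpace.PositiveCompacts (Matrix.unitaryGroup (Fin n) 𝕜))).map
    fun W : Matrix.unitaryGroup (Fin n) 𝕜 => W.val * firstCols 𝕜 n k

/-- The number `φ`, the real dimension of the field. -/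
noncomputable def phi (𝕜 : Type*) [RCLike 𝕜] : ℝ := (Module.finrank ℝ 𝕜 : ℝ)

theorem phi_real : phi ℝ = 1 := by simp [phi]

theorem phi_complex : phi ℂ = 2 := by simp [phi, Complex.finrank_real_complex]

/-!
Write `C = A - lam B` and let `D` be the diagonal matrix with entries
`τ (d_A - lam d_B)`, so that the modified pencil at `lam` is `C + U D Vᴴ`.

**Linear algebra.** The spans of `X₁` and `Y₁` have dimension `k`, so generically `Vᴴ` and `Uᴴ` are
injective on them. Pairing `(C + U D Vᴴ) z = 0` with `Y₁` then forces `Vᴴ z = 0` and `C z = 0`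
(`ker_add_mul_mul`). Hence the null vectors of the modified pencil at `lam` are exactly those of
`ker C ∩ ker Vᴴ`, which is a line (`IsDistinguishedBasis.finrank_ker_le_one`). Regularity follows
from the same argument at a point where `A - μ B` has maximal rank
(`det_pencil_rankCompleted_ne_zero`).

**Condition numbers.** Since `dim M - dim (A M + B M)` is a supermodular function of `M` with maximal
value `k`, the minimal reducing subspace `M` is itself reducing. As `ker C ∩ M` has dimension `k`,
both `C M` and `A M + B M` have dimension `dim M - k`, so `B M ⊆ C M`; thus `Yᴴ B X₁ = 0`
(`toEuclideanLin_mem_range_of_mem_minReducing`). Together with the adjoint statement, only the entry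
`y* B x` of `Yᴴ B X` survives (`inner_sum_toEuclideanLin_sum`).

**Probability.** By unitary invariance, the probability that `Vᴴ X` is singular is the same for all
isometric `n × k` matrices `X`. By Fubini, this probability vanishes for almost every full-rank
matrix in place of `X`, so it is zero (`ae_stiefelUniform_det_ne_zero`). The
coefficient vector of `x_i` is a unit vector spanning `ker (Vᴴ X)`, a line in `𝕜 ^ (k + 1)`, so
`|α|²` is a measurable function `lastCoordSq X` of `V`, and `|β|²` is the same kind of function of
`U`; this gives independence. The law of the line is unitarily invariant, so that the moments
of `|⟨a, w⟩|²`, for `a` a unit vector on the line, depend on `w` only through `‖w‖`. Integrating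
against the Gaussian function of `w` in both orders expresses them as quotients of Gaussian
moments, which are those of the beta distribution (`lintegral_lastCoordSq_pow`); on the unit
interval, the moments determine the law (`ext_of_lintegral_pow`).
-/

open Module Matrix MeasureTheory ProbabilityTheory

/-! ### Reducing subspaces and null vectors of rank-completed matrices -/

section LinearAlgebra

variable {𝕜 : Type*} [RCLike 𝕜] {n k : ℕ}

theorem finrank_map_add_finrank_inf_ker {K V W : Type*} [Field K] [AddCommGroup V] [Module K V]
    [FiniteDimensional K V] [AddCommGroup W] [Module K W] (f : V →ₗ[K] W) (M : Submodule K V) :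
    finrank K (M.map f) + finrank K (M ⊓ LinearMap.ker f : Submodule K V) = finrank K M := by
  have h := LinearMap.finrank_range_add_finrank_ker (f.domRestrict M)
  rw [LinearMap.range_domRestrict, LinearMap.ker_domRestrict] at h
  rw [← h, ← Submodule.map_comap_subtype, Submodule.finrank_map_subtype_eq]

theorem rank_add_finrank_ker (C : Matrix (Fin n) (Fin n) 𝕜) :
    C.rank + finrank 𝕜 (LinearMap.ker (toEuclideanLin C)) = n := by
  have h := LinearMap.finrank_range_add_finrank_ker (toEuclideanLin C)
  rw [finrank_euclideanSpace_fin] at h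
  rw [toEuclideanLin, toLpLin_eq_toLin] at h ⊢
  rwa [← rank_eq_finrank_range_toLin] at h

theorem bddAbove_rank (A B : Matrix (Fin n) (Fin n) 𝕜) :
    BddAbove (Set.range fun ζ : 𝕜 => (A - ζ • B).rank) :=
  ⟨n, by rintro _ ⟨ζ, rfl⟩; simpa using (A - ζ • B).rank_le_width⟩

theorem rank_le_nrank (A B : Matrix (Fin n) (Fin n) 𝕜) (ζ : 𝕜) :
    (A - ζ • B).rank ≤ nrank A B :=
  le_ciSup (bddAbove_rank A B) ζ

theorem exists_rank_eq_nrank (A B : Matrix (Fin n) (Fin n) 𝕜) :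
    ∃ ζ : 𝕜, (A - ζ • B).rank = nrank A B :=
  Nat.sSup_mem (Set.range_nonempty _) (bddAbove_rank A B)

theorem conjTranspose_sub_smul (A B : Matrix (Fin n) (Fin n) 𝕜) (ζ : 𝕜) :
    (A - ζ • B)ᴴ = Aᴴ - star ζ • Bᴴ := by
  rw [conjTranspose_sub, conjTranspose_smul]

open scoped ComplexOrder in
theorem nrank_conjTranspose (A B : Matrix (Fin n) (Fin n) 𝕜) : nrank Aᴴ Bᴴ = nrank A B := by
  unfold nrank
  refine (Equiv.iSup_congr (Equiv.ofBijective star star_involutive.bijective) fun ζ => ?_).symm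
  change (Aᴴ - star ζ • Bᴴ).rank = _
  rw [← conjTranspose_sub_smul, rank_conjTranspose]

/-- A subspace `M` loses at most `k` dimensions under a pencil of normal rank `n - k`. -/
theorem finrank_le_finrank_map_sup_map_add {A B : Matrix (Fin n) (Fin n) 𝕜}
    (hrank : nrank A B + k = n) (M : Submodule 𝕜 (EuclideanSpace 𝕜 (Fin n))) :
    finrank 𝕜 M ≤ finrank 𝕜 (M.map (toEuclideanLin A) ⊔ M.map (toEuclideanLin B) :
      Submodule 𝕜 (EuclideanSpace 𝕜 (Fin n))) + k := by
  obtain ⟨ζ, hζ⟩ := exists_rank_eq_nrank A B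
  have h1 := finrank_map_add_finrank_inf_ker (toEuclideanLin (A - ζ • B)) M
  have h2 := rank_add_finrank_ker (A - ζ • B)
  have h3 := Submodule.finrank_mono (R := 𝕜)
    (inf_le_right : M ⊓ LinearMap.ker (toEuclideanLin (A - ζ • B)) ≤ _)
  have h4 : M.map (toEuclideanLin (A - ζ • B)) ≤
      M.map (toEuclideanLin A) ⊔ M.map (toEuclideanLin B) := by
    rintro _ ⟨v, hv, rfl⟩
    rw [map_sub, map_smul, LinearMap.sub_apply, LinearMap.smul_apply]
    exact sub_mem (Submodule.mem_sup_left ⟨v, hv, rfl⟩)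
      (Submodule.smul_mem _ _ (Submodule.mem_sup_right ⟨v, hv, rfl⟩))
  have h5 := Submodule.finrank_mono (R := 𝕜) h4
  omega

/-- Reducing subspaces are closed under intersection, because
`M ↦ dim M - dim (A M + B M)` is supermodular with maximal value `k`. -/
theorem IsReducing.inf {A B : Matrix (Fin n) (Fin n) 𝕜} (hrank : nrank A B + k = n)
    {M M' : Submodule 𝕜 (EuclideanSpace 𝕜 (Fin n))} (h : IsReducing k A B M)
    (h' : IsReducing k A B M') : IsReducing k A B (M ⊓ M') := by
  unfold IsReducing at *
  set a := toEuclideanLin A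
  set b := toEuclideanLin B
  have h1 := finrank_le_finrank_map_sup_map_add hrank (M ⊓ M')
  have h2 := finrank_le_finrank_map_sup_map_add hrank (M ⊔ M')
  have h3 := Submodule.finrank_sup_add_finrank_inf_eq M M'
  have h4 := Submodule.finrank_sup_add_finrank_inf_eq (M.map a ⊔ M.map b) (M'.map a ⊔ M'.map b)
  have h5 : (M ⊓ M').map a ⊔ (M ⊓ M').map b ≤
      (M.map a ⊔ M.map b) ⊓ (M'.map a ⊔ M'.map b) :=
    le_inf (sup_le_sup (Submodule.map_mono inf_le_left) (Submodule.map_mono inf_le_left))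
      (sup_le_sup (Submodule.map_mono inf_le_right) (Submodule.map_mono inf_le_right))
  have h6 := Submodule.finrank_mono (R := 𝕜) h5
  have h7 : (M ⊔ M').map a ⊔ (M ⊔ M').map b = (M.map a ⊔ M.map b) ⊔ (M'.map a ⊔ M'.map b) := by
    rw [Submodule.map_sup, Submodule.map_sup, sup_sup_sup_comm]
  change _ ≤ finrank 𝕜 ((M ⊔ M').map a ⊔ (M ⊔ M').map b : Submodule 𝕜 _) + k at h2
  change _ ≤ finrank 𝕜 ((M ⊓ M').map a ⊔ (M ⊓ M').map b : Submodule 𝕜 _) + k at h1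
  rw [h7] at h2
  omega

/-- If there is a reducing subspace at all, then the smallest one is reducing. -/
theorem isReducing_minReducing {A B : Matrix (Fin n) (Fin n) 𝕜} (hrank : nrank A B + k = n)
    (hne : ∃ M, IsReducing k A B M) : IsReducing k A B (minReducing k A B) := by
  classical
  obtain ⟨M, hM, hmin⟩ := WellFounded.has_min (wellFounded_lt (α := Submodule 𝕜
    (EuclideanSpace 𝕜 (Fin n)))) {M | IsReducing k A B M} hne
  have : minReducing k A B = M := by
    refine le_antisymm (sInf_le hM) (le_sInf fun M' hM' => ?_)
    have h : M ⊓ M' = M := by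
      by_contra hne
      exact hmin _ (IsReducing.inf hrank hM hM') (lt_of_le_of_ne inf_le_left hne)
    exact inf_eq_left.mp h
  rwa [this]

/-- On the part of `ker (A - lam B)` inside the minimal reducing subspace `M`, the image under `B`
is contained in the range of `A - lam B`: both `(A - lam B) M` and `A M + B M` have
dimension `dim M - k`, so they coincide. -/
theorem toEuclideanLin_mem_range_of_mem_minReducing {A B : Matrix (Fin n) (Fin n) 𝕜}
    (hrank : nrank A B + k = n) {lam : 𝕜} {X : Fin (k + 1) → EuclideanSpace 𝕜 (Fin n)}
    (hX : IsDistinguishedBasis k A B lam X) (j : Fin k) :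
    toEuclideanLin B (X j.castSucc) ∈ LinearMap.range (toEuclideanLin (A - lam • B)) := by
  have hli : LinearIndependent 𝕜 X := hX.orthonormal.linearIndependent
  have hk1 : finrank 𝕜 (pencilKer A B lam) = k + 1 := by
    rw [← hX.span_eq, finrank_span_eq_card hli, Fintype.card_fin]
  have hk : finrank 𝕜 (pencilKer A B lam ⊓ minReducing k A B :
      Submodule 𝕜 (EuclideanSpace 𝕜 (Fin n))) = k := by
    rw [← hX.span_init_eq, finrank_span_eq_card (b := fun j : Fin k => X j.castSucc)
      (hli.comp _ (Fin.castSucc_injective k)),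
      Fintype.card_fin]
  have hne : ∃ M, IsReducing k A B M := by
    -- without reducing subspaces, the intersection is the whole space
    by_contra hne
    have : minReducing k A B = ⊤ := by
      have : {M | IsReducing k A B M} = ∅ := by
        ext M; simpa using fun h => hne ⟨M, h⟩
      rw [minReducing, this, sInf_empty]
    rw [this, inf_top_eq, hk1] at hk
    omega
  have hred := isReducing_minReducing hrank hne
  have hmem : X j.castSucc ∈ minReducing k A B := by
    have : X j.castSucc ∈ pencilKer A B lam ⊓ minReducing k A B := by
      rw [← hX.span_init_eq]; exact Submodule.subset_span ⟨j, rfl⟩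
    exact this.2
  set M := minReducing k A B
  have h1 := finrank_map_add_finrank_inf_ker (toEuclideanLin (A - lam • B)) M
  have h4 : M.map (toEuclideanLin (A - lam • B)) ≤
      M.map (toEuclideanLin A) ⊔ M.map (toEuclideanLin B) := by
    rintro _ ⟨v, hv, rfl⟩
    rw [map_sub, map_smul, LinearMap.sub_apply, LinearMap.smul_apply]
    exact sub_mem (Submodule.mem_sup_left ⟨v, hv, rfl⟩)
      (Submodule.smul_mem _ _ (Submodule.mem_sup_right ⟨v, hv, rfl⟩))
  unfold IsReducing at hred
  rw [inf_comm, pencilKer] at hk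
  have h5 := Submodule.eq_of_le_of_finrank_eq h4 (by omega)
  have h6 : toEuclideanLin B (X j.castSucc) ∈ M.map (toEuclideanLin (A - lam • B)) := by
    rw [h5]; exact Submodule.mem_sup_right ⟨_, hmem, rfl⟩
  obtain ⟨v, -, hv⟩ := h6
  exact ⟨v, hv⟩

theorem inner_toEuclideanLin_left {m : ℕ} (C : Matrix (Fin m) (Fin n) 𝕜)
    (v : EuclideanSpace 𝕜 (Fin m)) (w : EuclideanSpace 𝕜 (Fin n)) :
    inner 𝕜 v (toEuclideanLin C w) = inner 𝕜 (toEuclideanLin Cᴴ v) w := by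
  rw [toEuclideanLin_conjTranspose_eq_adjoint, LinearMap.adjoint_inner_left]

theorem toEuclideanLin_mul {l m : ℕ} (C : Matrix (Fin l) (Fin m) 𝕜) (D : Matrix (Fin m) (Fin n) 𝕜)
    (v : EuclideanSpace 𝕜 (Fin n)) :
    toEuclideanLin (C * D) v = toEuclideanLin C (toEuclideanLin D v) := by
  ext i
  simp [mulVec_mulVec]

theorem IsDistinguishedBasis.mem_ker {A B : Matrix (Fin n) (Fin n) 𝕜} {lam : 𝕜}
    {X : Fin (k + 1) → EuclideanSpace 𝕜 (Fin n)} (hX : IsDistinguishedBasis k A B lam X)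
    (j : Fin (k + 1)) : toEuclideanLin (A - lam • B) (X j) = 0 := by
  have : X j ∈ pencilKer A B lam := by rw [← hX.span_eq]; exact Submodule.subset_span ⟨j, rfl⟩
  exact this

theorem IsDistinguishedBasis.inner_eq_zero {A B : Matrix (Fin n) (Fin n) 𝕜}
    (hrank : nrank A B + k = n) {lam : 𝕜} {X : Fin (k + 1) → EuclideanSpace 𝕜 (Fin n)}
    (hX : IsDistinguishedBasis k A B lam X) {y : EuclideanSpace 𝕜 (Fin n)}
    (hy : toEuclideanLin (A - lam • B)ᴴ y = 0) (j : Fin k) :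
    inner 𝕜 y (toEuclideanLin B (X j.castSucc)) = 0 := by
  obtain ⟨v, hv⟩ := toEuclideanLin_mem_range_of_mem_minReducing hrank hX j
  rw [← hv, inner_toEuclideanLin_left, hy, inner_zero_left]

/-- In the distinguished bases, `Y* B X` has a single nonzero entry. -/
theorem inner_sum_toEuclideanLin_sum {A B : Matrix (Fin n) (Fin n) 𝕜}
    (hrank : nrank A B + k = n) {lam : 𝕜} {X Y : Fin (k + 1) → EuclideanSpace 𝕜 (Fin n)}
    (hX : IsDistinguishedBasis k A B lam X) (hY : IsDistinguishedBasis k Aᴴ Bᴴ (star lam) Y)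
    (a b : Fin (k + 1) → 𝕜) :
    inner 𝕜 (∑ j, b j • Y j) (toEuclideanLin B (∑ j, a j • X j)) =
      star (b (Fin.last k)) * a (Fin.last k) *
        inner 𝕜 (Y (Fin.last k)) (toEuclideanLin B (X (Fin.last k))) := by
  have hYker : ∀ j, toEuclideanLin (A - lam • B)ᴴ (Y j) = 0 := fun j => by
    rw [conjTranspose_sub_smul]; exact hY.mem_ker j
  have hx : ∀ y, toEuclideanLin (A - lam • B)ᴴ y = 0 →
      inner 𝕜 y (toEuclideanLin B (∑ j, a j • X j)) =
        a (Fin.last k) * inner 𝕜 y (toEuclideanLin B (X (Fin.last k))) := by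
    intro y hy
    rw [map_sum, inner_sum, Fin.sum_univ_castSucc, Finset.sum_eq_zero, zero_add, map_smul,
      inner_smul_right]
    intro j _
    rw [map_smul, inner_smul_right, hX.inner_eq_zero hrank hy, mul_zero]
  have hy : ∀ j : Fin k, inner 𝕜 (Y j.castSucc) (toEuclideanLin B (X (Fin.last k))) = 0 := by
    intro j
    rw [inner_toEuclideanLin_left, ← inner_conj_symm,
      hY.inner_eq_zero (by rwa [nrank_conjTranspose]) _ j, map_zero]
    rw [conjTranspose_sub_smul, star_star, conjTranspose_conjTranspose, conjTranspose_conjTranspose]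
    exact hX.mem_ker _
  rw [sum_inner, Fin.sum_univ_castSucc, Finset.sum_eq_zero, zero_add, inner_smul_left,
    hx _ (hYker _), ← mul_assoc]
  · rfl
  · intro j _
    rw [inner_smul_left, hx _ (hYker _), hy, mul_zero, mul_zero]

/-- If `Uᴴ` is injective on a `k`-dimensional space of left null vectors of `C` and `D` is
invertible, then every null vector of `C + U D Vᴴ` is a null vector of both `Vᴴ` and `C`. -/
theorem ker_add_mul_mul {C : Matrix (Fin n) (Fin n) 𝕜} {U V : Matrix (Fin n) (Fin k) 𝕜}
    {D : Matrix (Fin k) (Fin k) 𝕜} (hD : IsUnit D)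
    {S : Submodule 𝕜 (EuclideanSpace 𝕜 (Fin n))} (hS : finrank 𝕜 S = k)
    (hSC : ∀ y ∈ S, toEuclideanLin Cᴴ y = 0) (hU : ∀ y ∈ S, toEuclideanLin Uᴴ y = 0 → y = 0)
    {z : EuclideanSpace 𝕜 (Fin n)} (hz : toEuclideanLin (C + U * D * Vᴴ) z = 0) :
    toEuclideanLin Vᴴ z = 0 ∧ toEuclideanLin C z = 0 := by
  have hz' : toEuclideanLin C z + toEuclideanLin U (toEuclideanLin D (toEuclideanLin Vᴴ z)) = 0 := by
    rw [← hz, map_add, LinearMap.add_apply, toEuclideanLin_mul, toEuclideanLin_mul]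
  have hker := finrank_map_add_finrank_inf_ker (toEuclideanLin Uᴴ) S
  have hbot : S ⊓ LinearMap.ker (toEuclideanLin Uᴴ) = ⊥ :=
    (Submodule.eq_bot_iff _).mpr fun y hy => hU y hy.1 hy.2
  have htop : S.map (toEuclideanLin Uᴴ) = ⊤ := by
    refine Submodule.eq_top_of_finrank_eq ?_
    rw [hbot, finrank_bot, add_zero, hS] at hker
    rw [hker, finrank_euclideanSpace_fin]
  have hDV : toEuclideanLin D (toEuclideanLin Vᴴ z) = 0 := by
    have hall : ∀ u : EuclideanSpace 𝕜 (Fin k),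
        inner 𝕜 u (toEuclideanLin D (toEuclideanLin Vᴴ z)) = 0 := by
      intro u
      have hu : u ∈ S.map (toEuclideanLin Uᴴ) := by rw [htop]; trivial
      obtain ⟨y, hy, rfl⟩ := hu
      rw [← inner_toEuclideanLin_left]
      have := congrArg (inner 𝕜 y) hz'
      rwa [inner_add_right, inner_toEuclideanLin_left C, hSC y hy, inner_zero_left, zero_add,
        inner_zero_right] at this
    exact inner_self_eq_zero.mp (hall _)
  constructor
  · obtain ⟨D', hD'⟩ := hD.exists_left_inv
    have := congrArg (toEuclideanLin D') hDV
    rw [← toEuclideanLin_mul, hD', map_zero] at this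
    simpa [toLpLin_apply] using this
  · rwa [hDV, map_zero, add_zero] at hz'

end LinearAlgebra

/-! ### The uniform distribution on the Stiefel manifold -/

section Stiefel

variable {𝕜 : Type*} [RCLike 𝕜] {n k : ℕ}

instance secondCountableTopology_matrix : SecondCountableTopology (Matrix (Fin n) (Fin k) 𝕜) :=
  inferInstanceAs (SecondCountableTopology (Fin n → Fin k → 𝕜))

instance isProbabilityMeasure_haarMeasure_unitaryGroup :
    IsProbabilityMeasure (Measure.haarMeasure
      (⊤ : TopologicalSpace.PositiveCompacts (unitaryGroup (Fin n) 𝕜))) :=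
  ⟨Measure.haarMeasure_self
    (K₀ := (⊤ : TopologicalSpace.PositiveCompacts (unitaryGroup (Fin n) 𝕜)))⟩

theorem measurable_mul_firstCols :
    Measurable fun W : unitaryGroup (Fin n) 𝕜 => W.val * firstCols 𝕜 n k :=
  Continuous.measurable (by fun_prop)

instance isProbabilityMeasure_stiefelUniform : IsProbabilityMeasure (stiefelUniform 𝕜 n k) :=
  Measure.isProbabilityMeasure_map measurable_mul_firstCols.aemeasurable

theorem map_mul_stiefelUniform (W : unitaryGroup (Fin n) 𝕜) :
    (stiefelUniform 𝕜 n k).map (fun V => W.val * V) = stiefelUniform 𝕜 n k := by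
  have hW : Measurable fun V : Matrix (Fin n) (Fin k) 𝕜 => W.val * V :=
    Continuous.measurable (by fun_prop)
  unfold stiefelUniform
  rw [Measure.map_map hW measurable_mul_firstCols]
  conv_rhs => rw [← map_mul_left_eq_self (Measure.haarMeasure
      (⊤ : TopologicalSpace.PositiveCompacts (unitaryGroup (Fin n) 𝕜))) W]
  rw [Measure.map_map measurable_mul_firstCols (measurable_const_mul W)]
  congr 1
  ext1 W'
  simp [Matrix.mul_assoc]

theorem conjTranspose_mul_apply_eq_inner {m : ℕ} (A : Matrix (Fin m) (Fin n) 𝕜)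
    (B : Matrix (Fin m) (Fin k) 𝕜) (i : Fin n) (j : Fin k) :
    (Aᴴ * B) i j = inner 𝕜 (WithLp.toLp 2 fun l => A l i : EuclideanSpace 𝕜 (Fin m))
      (WithLp.toLp 2 fun l => B l j) := by
  simp [Matrix.mul_apply, PiLp.inner_apply, mul_comm]

theorem firstCols_isometry (hkn : k ≤ n) : (firstCols 𝕜 n k)ᴴ * firstCols 𝕜 n k = 1 := by
  ext i j
  simp only [firstCols, Matrix.mul_apply, conjTranspose_apply, of_apply, one_apply]
  rw [Finset.sum_eq_single (Fin.castLE hkn i)]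
  · simp [Fin.ext_iff]
  · intro l _ hl
    have : ¬ ((l : ℕ) = i) := fun h => hl (Fin.ext h)
    simp [this]
  · simp

/-- Every isometric `n × k` matrix consists of the first `k` columns of a unitary matrix. -/
theorem exists_unitary_mul_firstCols (hkn : k ≤ n) {X : Matrix (Fin n) (Fin k) 𝕜}
    (hX : Xᴴ * X = 1) : ∃ W : unitaryGroup (Fin n) 𝕜, W.val * firstCols 𝕜 n k = X := by
  let col : Fin k → EuclideanSpace 𝕜 (Fin n) := fun j => WithLp.toLp 2 fun i => X i j
  have hcol : Orthonormal 𝕜 col := by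
    rw [orthonormal_iff_ite]
    intro i j
    rw [← conjTranspose_mul_apply_eq_inner, hX, one_apply]
  let v : Fin n → EuclideanSpace 𝕜 (Fin n) := fun i => if h : (i : ℕ) < k then col ⟨i, h⟩ else 0
  obtain ⟨b, hb⟩ := Orthonormal.exists_orthonormalBasis_extension_of_card_eq
    (𝕜 := 𝕜) (E := EuclideanSpace 𝕜 (Fin n)) (ι := Fin n) (by simp) (v := v)
    (s := {i | (i : ℕ) < k}) (by
      have hs : Set.domRestrict {i : Fin n | (i : ℕ) < k} v =
          col ∘ fun i : {i : Fin n | (i : ℕ) < k} => ⟨i.1, i.2⟩ := by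
        ext1 i
        have : ((i : Fin n) : ℕ) < k := i.2
        simp [v, this]
      rw [hs]
      refine hcol.comp _ fun i j hij => ?_
      simpa [Fin.ext_iff, Subtype.ext_iff] using hij)
  let W : Matrix (Fin n) (Fin n) 𝕜 := Matrix.of fun i j => b j i
  have hW : W ∈ unitaryGroup (Fin n) 𝕜 := by
    rw [mem_unitaryGroup_iff', star_eq_conjTranspose]
    ext i j
    rw [conjTranspose_mul_apply_eq_inner, one_apply]
    exact orthonormal_iff_ite.mp b.orthonormal i j
  refine ⟨⟨W, hW⟩, ?_⟩
  ext i j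
  rw [Matrix.mul_apply, Finset.sum_eq_single (Fin.castLE hkn j)]
  · have := hb (Fin.castLE hkn j) (by simp)
    simp [W, firstCols, this, v, col]
  · intro l _ hl
    have : ¬ ((l : ℕ) = j) := fun h => hl (Fin.ext h)
    simp [firstCols, this]
  · simp

theorem exists_unitary_mul_eq (hkn : k ≤ n) {X X' : Matrix (Fin n) (Fin k) 𝕜}
    (hX : Xᴴ * X = 1) (hX' : X'ᴴ * X' = 1) : ∃ W : unitaryGroup (Fin n) 𝕜, W.val * X = X' := by
  obtain ⟨W, rfl⟩ := exists_unitary_mul_firstCols hkn hX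
  obtain ⟨W', rfl⟩ := exists_unitary_mul_firstCols hkn hX'
  refine ⟨W' * W⁻¹, ?_⟩
  rw [← Matrix.mul_assoc, ← Submonoid.coe_mul, inv_mul_cancel_right]

theorem ae_stiefelUniform_isometry (hkn : k ≤ n) :
    ∀ᵐ V ∂stiefelUniform 𝕜 n k, Vᴴ * V = 1 := by
  unfold stiefelUniform
  rw [ae_map_iff measurable_mul_firstCols.aemeasurable]
  · refine Filter.Eventually.of_forall fun W => ?_
    have hW : (W.val)ᴴ * W.val = 1 := mem_unitaryGroup_iff'.mp W.2
    rw [conjTranspose_mul, Matrix.mul_assoc, ← Matrix.mul_assoc _ W.val, hW, Matrix.one_mul,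
      firstCols_isometry hkn]
  · exact (isClosed_eq (by fun_prop) continuous_const).measurableSet

/-- For isometric `V`, almost every matrix `G` (for Lebesgue measure) has `det (Vᴴ G) ≠ 0`: along
the line `G + t V`, the determinant is the characteristic polynomial of `-Vᴴ G`. -/
theorem ae_addHaar_det_ne_zero {V : Matrix (Fin n) (Fin k) 𝕜} (hV : Vᴴ * V = 1)
    (ν : Measure (Fin n → Fin k → 𝕜)) [ν.IsAddHaarMeasure] :
    ∀ᵐ G ∂ν, (Vᴴ * Matrix.of G).det ≠ 0 := by
  let L : 𝕜 →ₗ[𝕜] (Fin n → Fin k → 𝕜) := LinearMap.toSpanSingleton 𝕜 _ (fun i j => V i j)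
  refine ae_mem_of_ae_add_linearMap_mem (s := {G | (Vᴴ * Matrix.of G).det ≠ 0}) L
    (Measure.addHaar : Measure 𝕜) ν ?_ fun G => ?_
  · refine IsOpen.measurableSet (isOpen_ne_fun ?_ continuous_const)
    exact Continuous.matrix_det (Continuous.matrix_mul continuous_const continuous_id)
  · have hfin : {t : 𝕜 | (-(Vᴴ * Matrix.of G)).charpoly.IsRoot t}.Finite :=
      Polynomial.finite_setOfPred_isRoot (charpoly_monic _).ne_zero
    have : ∀ᵐ t ∂(Measure.addHaar : Measure 𝕜), t ∉ {t : 𝕜 |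
        (-(Vᴴ * Matrix.of G)).charpoly.IsRoot t} :=
      measure_eq_zero_iff_ae_notMem.mp (hfin.measure_zero _)
    filter_upwards [this] with t ht
    have e : Matrix.of (G + L t) = Matrix.of G + t • V := by
      ext i j; simp [L]
    simp only [Polynomial.IsRoot, eval_charpoly] at ht ⊢
    rw [e, Matrix.mul_add, Matrix.mul_smul, hV]
    convert ht using 2
    rw [sub_neg_eq_add, add_comm, smul_one_eq_diagonal, scalar_apply]

theorem exists_ae_det_ne_zero (hkn : k ≤ n) :
    ∃ G : Matrix (Fin n) (Fin k) 𝕜, ∀ᵐ V ∂stiefelUniform 𝕜 n k, (Vᴴ * G).det ≠ 0 := by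
  have h : ∀ᵐ V ∂stiefelUniform 𝕜 n k, ∀ᵐ G ∂(Measure.addHaar : Measure (Fin n → Fin k → 𝕜)),
      (Vᴴ * Matrix.of G).det ≠ 0 := by
    filter_upwards [ae_stiefelUniform_isometry hkn] with V hV
    exact ae_addHaar_det_ne_zero hV _
  rw [Measure.ae_ae_comm] at h
  · obtain ⟨G, hG⟩ := h.exists
    exact ⟨Matrix.of G, hG⟩
  · refine IsOpen.measurableSet (isOpen_ne_fun (Continuous.matrix_det
      (Continuous.matrix_mul (Continuous.matrix_conjTranspose continuous_fst) continuous_snd))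
      continuous_const)

/-- A `k`-dimensional subspace is the range of an isometric matrix `X`, with projection `X Xᴴ`. -/
theorem exists_isometry_mul_conjTranspose {S : Submodule 𝕜 (EuclideanSpace 𝕜 (Fin n))}
    (hS : finrank 𝕜 S = k) : ∃ X : Matrix (Fin n) (Fin k) 𝕜, Xᴴ * X = 1 ∧
      ∀ z ∈ S, toEuclideanLin X (toEuclideanLin Xᴴ z) = z := by
  let b : OrthonormalBasis (Fin k) 𝕜 S := (stdOrthonormalBasis 𝕜 S).reindex (finCongr hS)
  let X : Matrix (Fin n) (Fin k) 𝕜 := Matrix.of fun i j => (b j : EuclideanSpace 𝕜 (Fin n)) i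
  refine ⟨X, ?_, fun z hz => ?_⟩
  · ext i j
    rw [conjTranspose_mul_apply_eq_inner, one_apply]
    exact orthonormal_iff_ite.mp b.orthonormal i j
  · have hc : toEuclideanLin Xᴴ z =
        WithLp.toLp 2 fun j => inner 𝕜 (b j : EuclideanSpace 𝕜 (Fin n)) z := by
      ext j
      simp [X, mul_comm, toLpLin_apply, mulVec, dotProduct, PiLp.inner_apply]
    rw [hc]
    ext i
    have h := congrArg (fun v : S => (v : EuclideanSpace 𝕜 (Fin n)) i) (b.sum_repr' ⟨z, hz⟩)
    simp only [Submodule.coe_sum, Submodule.coe_smul, Submodule.coe_inner] at h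
    refine Eq.trans ?_ h
    simp [X, mul_comm, WithLp.ofLp_sum, toLpLin_apply, mulVec, dotProduct]

theorem eq_zero_of_det_ne_zero {D : Matrix (Fin k) (Fin k) 𝕜} (hD : D.det ≠ 0)
    {z : EuclideanSpace 𝕜 (Fin k)} (hz : toEuclideanLin D z = 0) : z = 0 := by
  obtain ⟨D', hD'⟩ := ((isUnit_iff_isUnit_det _).mpr (isUnit_iff_ne_zero.mpr hD)).exists_left_inv
  have := congrArg (toEuclideanLin D') hz
  rw [← toEuclideanLin_mul, hD', map_zero] at this
  simpa [toLpLin_apply] using this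

/-- A matrix of full column rank factors through an isometric matrix. -/
theorem exists_isometry_mul_eq {G V : Matrix (Fin n) (Fin k) 𝕜} (hG : (Vᴴ * G).det ≠ 0) :
    ∃ (X : Matrix (Fin n) (Fin k) 𝕜) (R : Matrix (Fin k) (Fin k) 𝕜), Xᴴ * X = 1 ∧ X * R = G := by
  have hinj : Function.Injective (toEuclideanLin G) := by
    rw [injective_iff_map_eq_zero]
    intro z hz
    refine eq_zero_of_det_ne_zero hG ?_
    rw [toEuclideanLin_mul, hz, map_zero]
  obtain ⟨X, hX, hXS⟩ := exists_isometry_mul_conjTranspose (S := LinearMap.range (toEuclideanLin G))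
    (by rw [LinearMap.finrank_range_of_inj hinj, finrank_euclideanSpace_fin])
  refine ⟨X, Xᴴ * G, hX, toEuclideanLin.injective (LinearMap.ext fun z => ?_)⟩
  rw [toEuclideanLin_mul, toEuclideanLin_mul, hXS _ ⟨z, rfl⟩]

/-- For a fixed isometric `X`, almost surely `Vᴴ X` is invertible. The probability of the
exceptional set does not depend on `X`, by unitary invariance, and it vanishes for some `X`. -/
theorem ae_stiefelUniform_det_ne_zero (hkn : k ≤ n) {X : Matrix (Fin n) (Fin k) 𝕜}
    (hX : Xᴴ * X = 1) : ∀ᵐ V ∂stiefelUniform 𝕜 n k, (Vᴴ * X).det ≠ 0 := by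
  obtain ⟨G, hG⟩ := exists_ae_det_ne_zero (𝕜 := 𝕜) hkn
  obtain ⟨V₀, hV₀⟩ := hG.exists
  obtain ⟨X', R, hX', rfl⟩ := exists_isometry_mul_eq hV₀
  obtain ⟨W, rfl⟩ := exists_unitary_mul_eq hkn hX hX'
  have hW : Measurable fun V : Matrix (Fin n) (Fin k) 𝕜 => W.val * V :=
    Continuous.measurable (by fun_prop)
  rw [← map_mul_stiefelUniform W, ae_map_iff hW.aemeasurable] at hG
  · filter_upwards [hG] with V hV
    have hWW : (W.val)ᴴ * W.val = 1 := mem_unitaryGroup_iff'.mp W.2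
    rw [← Matrix.mul_assoc, det_mul, conjTranspose_mul, Matrix.mul_assoc,
      ← Matrix.mul_assoc _ W.val, hWW, Matrix.one_mul] at hV
    exact left_ne_zero_of_mul hV
  · exact IsOpen.measurableSet (isOpen_ne_fun (by fun_prop) continuous_const)

theorem ae_stiefelUniform_ker_inf (hkn : k ≤ n) {S : Submodule 𝕜 (EuclideanSpace 𝕜 (Fin n))}
    (hS : finrank 𝕜 S = k) :
    ∀ᵐ V ∂stiefelUniform 𝕜 n k, ∀ z ∈ S, toEuclideanLin Vᴴ z = 0 → z = 0 := by
  obtain ⟨X, hX, hXS⟩ := exists_isometry_mul_conjTranspose hS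
  filter_upwards [ae_stiefelUniform_det_ne_zero hkn hX] with V hV z hz hVz
  rw [← hXS z hz, ← toEuclideanLin_mul] at hVz
  rw [← hXS z hz, eq_zero_of_det_ne_zero hV hVz, map_zero]

end Stiefel

/-! ### Moments of the beta distribution -/

section Beta

open Polynomial in
/-- A finite measure on the unit interval is determined by its moments (Weierstrass). -/
theorem ext_of_lintegral_pow {μ ν : Measure ℝ} [IsProbabilityMeasure μ] [IsProbabilityMeasure ν]
    (hμ : ∀ᵐ x ∂μ, x ∈ Set.Icc (0 : ℝ) 1) (hν : ∀ᵐ x ∂ν, x ∈ Set.Icc (0 : ℝ) 1)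
    (h : ∀ m : ℕ, ∫⁻ x, ENNReal.ofReal (x ^ m) ∂μ = ∫⁻ x, ENNReal.ofReal (x ^ m) ∂ν) :
    μ = ν := by
  have hint : ∀ (κ : Measure ℝ) [IsProbabilityMeasure κ], (∀ᵐ x ∂κ, x ∈ Set.Icc (0 : ℝ) 1) →
      ∀ m : ℕ, Integrable (fun x => x ^ m) κ := by
    intro κ _ hκ m
    refine Integrable.of_bound (by fun_prop) 1 ?_
    filter_upwards [hκ] with x hx
    rw [norm_pow, Real.norm_of_nonneg hx.1]
    exact pow_le_one₀ hx.1 hx.2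
  have hmom : ∀ m : ℕ, ∫ x, x ^ m ∂μ = ∫ x, x ^ m ∂ν := by
    intro m
    rw [integral_eq_lintegral_of_nonneg_ae, integral_eq_lintegral_of_nonneg_ae, h m]
    · filter_upwards [hν] with x hx using pow_nonneg hx.1 m
    · fun_prop
    · filter_upwards [hμ] with x hx using pow_nonneg hx.1 m
    · fun_prop
  have hpint : ∀ (κ : Measure ℝ) [IsProbabilityMeasure κ], (∀ᵐ x ∂κ, x ∈ Set.Icc (0 : ℝ) 1) →
      ∀ p : ℝ[X], Integrable (fun x => p.eval x) κ := by
    intro κ _ hκ p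
    simp_rw [eval_eq_sum_range]
    exact integrable_finsetSum _ fun i _ => (hint κ hκ i).const_mul _
  have hpoly : ∀ p : ℝ[X], ∫ x, p.eval x ∂μ = ∫ x, p.eval x ∂ν := by
    intro p
    simp_rw [eval_eq_sum_range]
    rw [integral_finsetSum _ fun i _ => (hint μ hμ i).const_mul _,
      integral_finsetSum _ fun i _ => (hint ν hν i).const_mul _]
    simp_rw [integral_const_mul, hmom]
  refine ext_of_forall_integral_eq_of_IsFiniteMeasure fun f => ?_
  have hclose : ∀ ε > 0, |∫ x, f x ∂μ - ∫ x, f x ∂ν| ≤ ε := by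
    intro ε hε
    obtain ⟨p, hp⟩ := exists_polynomial_near_of_continuousOn 0 1 f f.continuous.continuousOn
      (ε / 2) (half_pos hε)
    have key : ∀ (κ : Measure ℝ) [IsProbabilityMeasure κ],
        (∀ᵐ x ∂κ, x ∈ Set.Icc (0 : ℝ) 1) → |∫ x, p.eval x ∂κ - ∫ x, f x ∂κ| ≤ ε / 2 := by
      intro κ _ hκ
      rw [← integral_sub (hpint κ hκ p) (f.integrable κ)]
      have := norm_integral_le_of_norm_le_const (μ := κ) (f := fun x => p.eval x - f x)
        (C := ε / 2) (by filter_upwards [hκ] with x hx using (hp x hx).le)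
      simpa using this
    have h1 := abs_le.mp (key μ hμ)
    have h2 := abs_le.mp (key ν hν)
    rw [hpoly] at h1
    exact abs_le.mpr ⟨by linarith [h1.1, h2.2], by linarith [h1.2, h2.1]⟩
  have := le_of_forall_pos_le_add (a := |∫ x, f x ∂μ - ∫ x, f x ∂ν|) (b := 0)
    fun ε hε => by simpa using hclose ε hε
  exact sub_eq_zero.mp (abs_nonpos_iff.mp this)

theorem lintegral_pow_betaMeasure {a b : ℝ} (ha : 0 < a) (hb : 0 < b) (m : ℕ) :
    ∫⁻ x, ENNReal.ofReal (x ^ m) ∂betaMeasure a b =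
      ENNReal.ofReal (beta (a + m) b / beta a b) := by
  have ham : 0 < a + m := by positivity
  have hmeas : ∀ c d : ℝ, Measurable (betaPDF c d) := fun c d =>
    (measurable_betaPDFReal c d).ennreal_ofReal
  have hb0 := beta_pos ha hb
  have hbm := beta_pos ham hb
  rw [betaMeasure, lintegral_withDensity_eq_lintegral_mul _ (hmeas a b) (by fun_prop)]
  have : ∀ x : ℝ, (betaPDF a b * fun x => ENNReal.ofReal (x ^ m)) x =
      ENNReal.ofReal (beta (a + m) b / beta a b) * betaPDF (a + m) b x := by
    intro x
    simp only [Pi.mul_apply]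
    by_cases hx : 0 < x ∧ x < 1
    · rw [betaPDF_of_pos_lt_one hx.1 hx.2, betaPDF_of_pos_lt_one hx.1 hx.2,
        ← ENNReal.ofReal_mul' (pow_nonneg hx.1.le m), ← ENNReal.ofReal_mul (by positivity)]
      congr 1
      rw [show a + m - 1 = (a - 1) + m by ring, Real.rpow_add hx.1, Real.rpow_natCast]
      field_simp
    · rw [betaPDF_eq, betaPDF_eq, if_neg hx, if_neg hx]
      simp
  simp_rw [this]
  rw [lintegral_const_mul _ (hmeas _ _), lintegral_betaPDF_eq_one ham hb, mul_one]

theorem ae_betaMeasure_mem_Icc (a b : ℝ) : ∀ᵐ x ∂betaMeasure a b, x ∈ Set.Icc (0 : ℝ) 1 := by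
  have hmeas : Measurable (betaPDF a b) := (measurable_betaPDFReal a b).ennreal_ofReal
  rw [betaMeasure, ae_withDensity_iff hmeas]
  refine Filter.Eventually.of_forall fun x hx => ?_
  by_contra h
  refine hx ?_
  rw [betaPDF_eq, if_neg fun h' => h ⟨h'.1.le, h'.2.le⟩, ENNReal.ofReal_zero]

end Beta

/-! ### Moments of the Gaussian function -/

section Gaussian

/-- The radial moments of the Gaussian function on a real normed space of dimension `d`. -/
theorem integral_norm_pow_mul_exp {E : Type*} [NormedAddCommGroup E] [NormedSpace ℝ E]
    [FiniteDimensional ℝ E] [Nontrivial E] [MeasurableSpace E] [BorelSpace E] (μ : Measure E)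
    [μ.IsAddHaarMeasure] (m : ℕ) :
    ∫ x, ‖x‖ ^ (2 * m) * Real.exp (-‖x‖ ^ 2) ∂μ =
      finrank ℝ E * μ.real (Metric.ball 0 1) / 2 * Real.Gamma ((finrank ℝ E : ℝ) / 2 + m) := by
  have hd : 1 ≤ finrank ℝ E := finrank_pos
  rw [integral_fun_norm_addHaar μ fun y => y ^ (2 * m) * Real.exp (-y ^ 2)]
  have h : ∫ y in Set.Ioi (0 : ℝ), y ^ (finrank ℝ E - 1) • (y ^ (2 * m) * Real.exp (-y ^ 2)) =
      ∫ y in Set.Ioi (0 : ℝ), y ^ ((finrank ℝ E : ℝ) - 1 + 2 * m) * Real.exp (-y ^ (2 : ℝ)) := by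
    refine setIntegral_congr_fun measurableSet_Ioi fun y hy => ?_
    have hy : 0 < y := hy
    simp only [smul_eq_mul]
    rw [← mul_assoc, ← pow_add, ← Real.rpow_natCast y (finrank ℝ E - 1 + 2 * m)]
    push_cast [Nat.cast_sub hd]
    rw [Real.rpow_two]
  have hd' : (1 : ℝ) ≤ finrank ℝ E := by exact_mod_cast hd
  have hm : (0 : ℝ) ≤ m := Nat.cast_nonneg m
  rw [h, integral_rpow_mul_exp_neg_rpow two_pos (by linarith), nsmul_eq_mul, smul_eq_mul,
    show ((finrank ℝ E : ℝ) - 1 + 2 * m + 1) / 2 = (finrank ℝ E : ℝ) / 2 + m by ring]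
  ring

theorem integral_norm_pow_mul_exp_pos {E : Type*} [NormedAddCommGroup E] [NormedSpace ℝ E]
    [FiniteDimensional ℝ E] [Nontrivial E] [MeasurableSpace E] [BorelSpace E] (μ : Measure E)
    [μ.IsAddHaarMeasure] (m : ℕ) : 0 < ∫ x, ‖x‖ ^ (2 * m) * Real.exp (-‖x‖ ^ 2) ∂μ := by
  rw [integral_norm_pow_mul_exp]
  have hd : (0 : ℝ) < finrank ℝ E := by exact_mod_cast finrank_pos
  have hb : 0 < μ.real (Metric.ball (0 : E) 1) :=
    ENNReal.toReal_pos (Metric.measure_ball_pos μ 0 one_pos).ne' measure_ball_lt_top.ne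
  exact mul_pos (by positivity) (Real.Gamma_pos_of_pos (by positivity))

variable {𝕜 : Type*} [RCLike 𝕜] {N : ℕ}

/-- Lebesgue measure on `𝕜 ^ N`, as the product of Haar measures on the factors. -/
noncomputable def euclideanHaar (𝕜 : Type*) [RCLike 𝕜] (N : ℕ) :
    Measure (EuclideanSpace 𝕜 (Fin N)) :=
  (Measure.pi fun _ : Fin N => (Measure.addHaar : Measure 𝕜)).map
    (PiLp.continuousLinearEquiv 2 𝕜 fun _ : Fin N => 𝕜).symm

instance isAddHaarMeasure_euclideanHaar : (euclideanHaar 𝕜 N).IsAddHaarMeasure :=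
  ContinuousLinearEquiv.isAddHaarMeasure_map _ _

theorem integral_euclideanHaar (f : EuclideanSpace 𝕜 (Fin N) → ℝ) :
    ∫ w, f w ∂euclideanHaar 𝕜 N =
      ∫ w, f (WithLp.toLp 2 w) ∂Measure.pi fun _ : Fin N => (Measure.addHaar : Measure 𝕜) := by
  rw [euclideanHaar]
  exact (PiLp.continuousLinearEquiv 2 𝕜 fun _ : Fin N => 𝕜).symm.toHomeomorph.measurableEmbedding
    |>.integral_map f

/-- Additive Haar measure is invariant under linear isometries, since they preserve the unit
ball. -/
theorem map_linearIsometryEquiv_addHaar {E : Type*} [NormedAddCommGroup E] [NormedSpace ℝ E]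
    [NormedSpace 𝕜 E] [FiniteDimensional ℝ E] [MeasurableSpace E] [BorelSpace E] (μ : Measure E)
    [μ.IsAddHaarMeasure] (f : E ≃ₗᵢ[𝕜] E) : μ.map f = μ := by
  have : (μ.map f).IsAddHaarMeasure := f.toContinuousLinearEquiv.isAddHaarMeasure_map μ
  have h := Measure.isAddLeftInvariant_eq_smul (μ.map f) μ
  have hball : μ.map f (Metric.ball 0 1) = μ (Metric.ball 0 1) := by
    rw [Measure.map_apply f.continuous.measurable Metric.isOpen_ball.measurableSet,
      f.preimage_ball, map_zero]
  have h0 : μ (Metric.ball (0 : E) 1) ≠ 0 := (Metric.measure_ball_pos μ 0 one_pos).ne'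
  have htop : μ (Metric.ball (0 : E) 1) ≠ ⊤ := measure_ball_lt_top.ne
  generalize Measure.addHaarScalarFactor (μ.map f) μ = c at h
  rw [h, Measure.smul_apply] at hball
  have hc : (c : ENNReal) = 1 := by
    have h1 : (c : ENNReal) * μ (Metric.ball (0 : E) 1) = 1 * μ (Metric.ball (0 : E) 1) := by
      rw [one_mul]; exact hball
    exact (ENNReal.mul_left_inj h0 htop).mp h1
  rw [h, ENNReal.coe_eq_one.mp hc, one_smul]

/-- A coordinate moment of the Gaussian function, by Fubini. -/
theorem integral_coord_pow_mul_exp {k : ℕ} (m : ℕ) :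
    ∫ w, ‖w (Fin.last k)‖ ^ (2 * m) * Real.exp (-‖w‖ ^ 2) ∂euclideanHaar 𝕜 (k + 1) =
      (∫ z : 𝕜, Real.exp (-‖z‖ ^ 2) ∂Measure.addHaar) ^ k *
        ∫ z : 𝕜, ‖z‖ ^ (2 * m) * Real.exp (-‖z‖ ^ 2) ∂Measure.addHaar := by
  rw [integral_euclideanHaar]
  let g : Fin (k + 1) → 𝕜 → ℝ := fun j z =>
    (if j = Fin.last k then ‖z‖ ^ (2 * m) else 1) * Real.exp (-‖z‖ ^ 2)
  have h : ∀ w : Fin (k + 1) → 𝕜, ‖(WithLp.toLp 2 w : EuclideanSpace 𝕜 _) (Fin.last k)‖ ^ (2 * m) *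
      Real.exp (-‖(WithLp.toLp 2 w : EuclideanSpace 𝕜 _)‖ ^ 2) = ∏ j, g j (w j) := by
    intro w
    rw [EuclideanSpace.norm_sq_eq, ← Finset.sum_neg_distrib, Real.exp_sum, Finset.prod_mul_distrib]
    congr 1
    rw [Finset.prod_ite_eq' Finset.univ (Fin.last k) fun j => ‖w j‖ ^ (2 * m)]
    simp
  simp_rw [h]
  rw [integral_fintype_prod_eq_prod, Fin.prod_univ_castSucc]
  simp [g, Fin.castSucc_ne_last]

theorem finrank_real_euclideanSpace :
    (finrank ℝ (EuclideanSpace 𝕜 (Fin N)) : ℝ) = phi 𝕜 * N := by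
  rw [← finrank_mul_finrank ℝ 𝕜 (EuclideanSpace 𝕜 (Fin N)), finrank_euclideanSpace_fin, phi,
    Nat.cast_mul]

theorem phi_pos : 0 < phi 𝕜 := by
  have : 0 < finrank ℝ 𝕜 := finrank_pos
  exact Nat.cast_pos.mpr this

/-- The quotient of a coordinate moment and the corresponding radial moment of the Gaussian
function is a moment of the beta distribution. -/
theorem integral_coord_div_integral_norm {k : ℕ} (hk : 1 ≤ k) (m : ℕ) :
    (∫ w, ‖w (Fin.last k)‖ ^ (2 * m) * Real.exp (-‖w‖ ^ 2) ∂euclideanHaar 𝕜 (k + 1)) /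
        ∫ w, ‖w‖ ^ (2 * m) * Real.exp (-‖w‖ ^ 2) ∂euclideanHaar 𝕜 (k + 1) =
      beta (phi 𝕜 / 2 + m) (phi 𝕜 * k / 2) / beta (phi 𝕜 / 2) (phi 𝕜 * k / 2) := by
  have hφ : 0 < phi 𝕜 := phi_pos
  have hk' : (0 : ℝ) < k := by exact_mod_cast hk
  have hA := integral_norm_pow_mul_exp (Measure.addHaar : Measure 𝕜)
  have hR := integral_norm_pow_mul_exp (euclideanHaar 𝕜 (k + 1))
  have hR0 := integral_coord_pow_mul_exp (𝕜 := 𝕜) (k := k) 0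
  have hRpos := integral_norm_pow_mul_exp_pos (euclideanHaar 𝕜 (k + 1)) 0
  have hApos := integral_norm_pow_mul_exp_pos (Measure.addHaar : Measure 𝕜) 0
  rw [finrank_real_euclideanSpace] at hR
  rw [← phi] at hA
  have hR00 := hR 0
  have hA00 := hA 0
  rw [integral_coord_pow_mul_exp, hR m, hA m]
  simp only [mul_zero, pow_zero, one_mul, Nat.cast_zero, add_zero] at hR0 hR00 hA00 hRpos hApos
  rw [hR0] at hR00 hRpos
  set A := ∫ z : 𝕜, Real.exp (-‖z‖ ^ 2) ∂Measure.addHaar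
  generalize phi 𝕜 * Measure.addHaar.real (Metric.ball (0 : 𝕜) 1) / 2 = c at *
  generalize phi 𝕜 * ((k + 1 : ℕ) : ℝ) *
    (euclideanHaar 𝕜 (k + 1)).real (Metric.ball 0 1) / 2 = C at *
  have e : phi 𝕜 * ((k + 1 : ℕ) : ℝ) / 2 = phi 𝕜 / 2 + phi 𝕜 * k / 2 := by push_cast; ring
  rw [e] at hR00 ⊢
  have ha : 0 < phi 𝕜 / 2 := by positivity
  have hb : 0 < phi 𝕜 * k / 2 := by positivity
  generalize phi 𝕜 / 2 = a at *
  generalize phi 𝕜 * k / 2 = b at *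
  have g1 := (Real.Gamma_pos_of_pos ha).ne'
  have g2 := (Real.Gamma_pos_of_pos hb).ne'
  have g3 := (Real.Gamma_pos_of_pos (add_pos ha hb)).ne'
  have g4 : Real.Gamma (a + b + m) ≠ 0 := (Real.Gamma_pos_of_pos (by positivity)).ne'
  have hc : c ≠ 0 := by rintro rfl; rw [hA00, zero_mul] at hApos; exact hApos.false
  have hC : C ≠ 0 := by rintro rfl; rw [hR00, zero_mul] at hRpos; exact hRpos.false
  rw [beta, beta, show a + m + b = a + b + m by ring]
  field_simp
  linear_combination hR00 - A ^ k * hA00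

end Gaussian

/-! ### Projection to the kernel of a full-rank matrix -/

section Residual

variable {𝕜 : Type*} [RCLike 𝕜] {n k N : ℕ}

/-- The component of `w` orthogonal to the columns of `T`. The formula presumes that these are
linearly independent, since the inverse of a singular matrix is `0` by convention. -/
noncomputable def residualVec (T : Matrix (Fin N) (Fin k) 𝕜) (w : EuclideanSpace 𝕜 (Fin N)) :
    EuclideanSpace 𝕜 (Fin N) :=
  w - toEuclideanLin (T * (Tᴴ * T)⁻¹ * Tᴴ) w

theorem residual_smul (T : Matrix (Fin N) (Fin k) 𝕜) (c : 𝕜) (w : EuclideanSpace 𝕜 (Fin N)) :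
    residualVec T (c • w) = c • residualVec T w := by
  rw [residualVec, residualVec, map_smul, smul_sub]

theorem residual_mul {Q : Matrix (Fin N) (Fin N) 𝕜} (hQ : Qᴴ * Q = 1)
    (T : Matrix (Fin N) (Fin k) 𝕜) (w : EuclideanSpace 𝕜 (Fin N)) :
    residualVec (Q * T) (toEuclideanLin Q w) = toEuclideanLin Q (residualVec T w) := by
  have h1 : (Q * T)ᴴ * (Q * T) = Tᴴ * T := by
    rw [conjTranspose_mul, Matrix.mul_assoc, ← Matrix.mul_assoc _ Q, hQ, Matrix.one_mul]
  have h2 : Q * T * (Tᴴ * T)⁻¹ * (Q * T)ᴴ * Q = Q * (T * (Tᴴ * T)⁻¹ * Tᴴ) := by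
    rw [conjTranspose_mul]
    simp only [Matrix.mul_assoc]
    rw [hQ, Matrix.mul_one]
  rw [residualVec, residualVec, h1, map_sub, ← toEuclideanLin_mul, h2, toEuclideanLin_mul]

theorem norm_toEuclideanLin {Q : Matrix (Fin n) (Fin k) 𝕜} (hQ : Qᴴ * Q = 1)
    (w : EuclideanSpace 𝕜 (Fin k)) : ‖toEuclideanLin Q w‖ = ‖w‖ := by
  have h : inner 𝕜 (toEuclideanLin Q w) (toEuclideanLin Q w) = inner 𝕜 w w := by
    rw [inner_toEuclideanLin_left, ← toEuclideanLin_mul, hQ]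
    simp
  rw [inner_self_eq_norm_sq_to_K, inner_self_eq_norm_sq_to_K] at h
  have h' : ‖toEuclideanLin Q w‖ ^ 2 = ‖w‖ ^ 2 := by exact_mod_cast h
  exact (pow_left_inj₀ (norm_nonneg _) (norm_nonneg _) two_ne_zero).mp h'

theorem finrank_ker_conjTranspose {T : Matrix (Fin (k + 1)) (Fin k) 𝕜} (hT : (Tᴴ * T).det ≠ 0) :
    finrank 𝕜 (LinearMap.ker (toEuclideanLin Tᴴ)) = 1 := by
  have h := LinearMap.finrank_range_add_finrank_ker (toEuclideanLin Tᴴ)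
  have hr : LinearMap.range (toEuclideanLin Tᴴ) = ⊤ := by
    rw [LinearMap.range_eq_top]
    intro v
    refine ⟨toEuclideanLin (T * (Tᴴ * T)⁻¹) v, ?_⟩
    rw [← toEuclideanLin_mul, ← Matrix.mul_assoc, mul_nonsing_inv _ (isUnit_iff_ne_zero.mpr hT)]
    simp
  rw [hr, finrank_top, finrank_euclideanSpace_fin, finrank_euclideanSpace_fin] at h
  omega

/-- If `T` has rank `k`, the residual is the projection to the line `ker Tᴴ`. -/
theorem residual_eq_inner_smul {T : Matrix (Fin (k + 1)) (Fin k) 𝕜} (hT : (Tᴴ * T).det ≠ 0)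
    {a : EuclideanSpace 𝕜 (Fin (k + 1))} (ha : ‖a‖ = 1) (hTa : toEuclideanLin Tᴴ a = 0)
    (w : EuclideanSpace 𝕜 (Fin (k + 1))) : residualVec T w = (inner 𝕜 a w : 𝕜) • a := by
  have hker : toEuclideanLin Tᴴ (residualVec T w) = 0 := by
    rw [residualVec, map_sub, ← toEuclideanLin_mul, ← Matrix.mul_assoc, ← Matrix.mul_assoc,
      mul_nonsing_inv _ (isUnit_iff_ne_zero.mpr hT), Matrix.one_mul, sub_self]
  have ha0 : (⟨a, hTa⟩ : LinearMap.ker (toEuclideanLin Tᴴ)) ≠ 0 := by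
    intro h
    have : a = 0 := congrArg Subtype.val h
    simp [this] at ha
  obtain ⟨c, hc⟩ := (finrank_eq_one_iff_of_nonzero' _ ha0).mp (finrank_ker_conjTranspose hT)
    ⟨residualVec T w, hker⟩
  have hc : c • a = residualVec T w := congrArg Subtype.val hc
  have h1 : inner 𝕜 a (residualVec T w) = inner 𝕜 a w := by
    rw [residualVec, inner_sub_right, Matrix.mul_assoc, toEuclideanLin_mul, inner_toEuclideanLin_left,
      hTa, inner_zero_left, sub_zero]
  rw [← h1, ← hc, inner_smul_right, inner_self_eq_norm_sq_to_K, ha]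
  simp

theorem norm_residual {T : Matrix (Fin (k + 1)) (Fin k) 𝕜} (hT : (Tᴴ * T).det ≠ 0)
    {a : EuclideanSpace 𝕜 (Fin (k + 1))} (ha : ‖a‖ = 1) (hTa : toEuclideanLin Tᴴ a = 0)
    (w : EuclideanSpace 𝕜 (Fin (k + 1))) : ‖residualVec T w‖ = ‖inner 𝕜 a w‖ := by
  rw [residual_eq_inner_smul hT ha hTa, norm_smul, ha, mul_one]

theorem exists_unit_mem_ker {T : Matrix (Fin (k + 1)) (Fin k) 𝕜} (hT : (Tᴴ * T).det ≠ 0) :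
    ∃ a : EuclideanSpace 𝕜 (Fin (k + 1)), ‖a‖ = 1 ∧ toEuclideanLin Tᴴ a = 0 := by
  obtain ⟨v, hv, -⟩ := finrank_eq_one_iff'.mp (finrank_ker_conjTranspose hT)
  have hv' : (v : EuclideanSpace 𝕜 (Fin (k + 1))) ≠ 0 := fun h => hv (Subtype.ext h)
  refine ⟨((‖(v : EuclideanSpace 𝕜 (Fin (k + 1)))‖⁻¹ : ℝ) : 𝕜) • v, ?_, ?_⟩
  · rw [norm_smul, RCLike.norm_ofReal, abs_of_nonneg (by positivity),
      inv_mul_cancel₀ (norm_ne_zero_iff.mpr hv')]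
  · rw [map_smul, LinearMap.mem_ker.mp v.2, smul_zero]

theorem continuous_toEuclideanLin_apply : Continuous fun p :
    Matrix (Fin n) (Fin k) 𝕜 × EuclideanSpace 𝕜 (Fin k) => toEuclideanLin p.1 p.2 := by
  simp only [toLpLin_apply]
  refine (PiLp.continuous_toLp 2 _).comp ?_
  exact Continuous.matrix_mulVec continuous_fst ((PiLp.continuous_ofLp 2 _).comp continuous_snd)

theorem measurable_residual : Measurable fun p :
    Matrix (Fin N) (Fin k) 𝕜 × EuclideanSpace 𝕜 (Fin N) => residualVec p.1 p.2 := by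
  have h : ∀ p : Matrix (Fin N) (Fin k) 𝕜 × EuclideanSpace 𝕜 (Fin N), residualVec p.1 p.2 =
      p.2 - ((p.1ᴴ * p.1).det)⁻¹ • toEuclideanLin (p.1 * (p.1ᴴ * p.1).adjugate * p.1ᴴ) p.2 := by
    intro p
    rw [residualVec, inv_def, Ring.inverse_eq_inv', Matrix.mul_smul, Matrix.smul_mul, map_smul,
      LinearMap.smul_apply]
  simp_rw [h]
  have h1 : Measurable fun p : Matrix (Fin N) (Fin k) 𝕜 × EuclideanSpace 𝕜 (Fin N) =>
      ((p.1ᴴ * p.1).det)⁻¹ := (Continuous.measurable (by fun_prop)).inv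
  have h2 : Measurable fun p : Matrix (Fin N) (Fin k) 𝕜 × EuclideanSpace 𝕜 (Fin N) =>
      toEuclideanLin (p.1 * (p.1ᴴ * p.1).adjugate * p.1ᴴ) p.2 :=
    (continuous_toEuclideanLin_apply.comp
      (Continuous.prodMk (by fun_prop) continuous_snd)).measurable
  exact measurable_snd.sub (h1.smul h2)

/-- The unitary matrices act transitively on unit vectors. -/
theorem exists_unitary_apply_eq (hN : 1 ≤ N) {u v : EuclideanSpace 𝕜 (Fin N)} (hu : ‖u‖ = 1)
    (hv : ‖v‖ = 1) : ∃ Q : unitaryGroup (Fin N) 𝕜, toEuclideanLin Q.val u = v := by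
  have key : ∀ z : EuclideanSpace 𝕜 (Fin N), ‖z‖ = 1 →
      (Matrix.of fun i (_ : Fin 1) => z i)ᴴ * (Matrix.of fun i (_ : Fin 1) => z i) = 1 := by
    intro z hz
    ext i j
    rw [conjTranspose_mul_apply_eq_inner, Subsingleton.elim j i, one_apply_eq]
    change inner 𝕜 z z = 1
    rw [inner_self_eq_norm_sq_to_K, hz]
    simp
  obtain ⟨Q, hQ⟩ := exists_unitary_mul_eq hN (key u hu) (key v hv)
  refine ⟨Q, ?_⟩
  ext i
  have := congrFun (congrFun hQ i) 0
  simpa [Matrix.mul_apply, toLpLin_apply, mulVec, dotProduct] using this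

end Residual

/-! ### The law of the last coordinate -/

section Law

variable {𝕜 : Type*} [RCLike 𝕜] {n k : ℕ}

/-- The matrix with columns `X j`. -/
def colMatrix {m : ℕ} (X : Fin m → EuclideanSpace 𝕜 (Fin n)) : Matrix (Fin n) (Fin m) 𝕜 :=
  Matrix.of fun i j => X j i

theorem colMatrix_isometry {m : ℕ} {X : Fin m → EuclideanSpace 𝕜 (Fin n)} (hX : Orthonormal 𝕜 X) :
    (colMatrix X)ᴴ * colMatrix X = 1 := by
  ext i j
  rw [conjTranspose_mul_apply_eq_inner, one_apply]
  exact orthonormal_iff_ite.mp hX i j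

theorem toEuclideanLin_colMatrix {m : ℕ} (X : Fin m → EuclideanSpace 𝕜 (Fin n))
    (a : EuclideanSpace 𝕜 (Fin m)) : toEuclideanLin (colMatrix X) a = ∑ j, a j • X j := by
  ext i
  simp [colMatrix, toLpLin_apply, mulVec, dotProduct, mul_comm, WithLp.ofLp_sum]

/-- A unitary matrix `Q` acting on the coordinates with respect to the columns of `X` is induced by
a unitary matrix of the whole space, namely `X Q Xᴴ + (1 - X Xᴴ)`. -/
theorem exists_unitary_conjTranspose_mul {m : ℕ} {X : Matrix (Fin n) (Fin m) 𝕜} (hX : Xᴴ * X = 1)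
    (Q : unitaryGroup (Fin m) 𝕜) : ∃ W : unitaryGroup (Fin n) 𝕜, Xᴴ * W.val = Q.val * Xᴴ := by
  have hQ : (Q.val)ᴴ * Q.val = 1 := mem_unitaryGroup_iff'.mp Q.2
  have hXX : ∀ {l : ℕ} (M : Matrix (Fin m) (Fin l) 𝕜), Xᴴ * (X * M) = M := fun M => by
    rw [← Matrix.mul_assoc, hX, Matrix.one_mul]
  have hQQ : ∀ {l : ℕ} (M : Matrix (Fin m) (Fin l) 𝕜), (Q.val)ᴴ * (Q.val * M) = M := fun M => by
    rw [← Matrix.mul_assoc, hQ, Matrix.one_mul]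
  have hW : X * Q.val * Xᴴ + (1 - X * Xᴴ) ∈ unitaryGroup (Fin n) 𝕜 := by
    rw [mem_unitaryGroup_iff', star_eq_conjTranspose]
    simp only [conjTranspose_add, conjTranspose_mul, conjTranspose_sub, conjTranspose_one,
      conjTranspose_conjTranspose, Matrix.add_mul, Matrix.mul_add, Matrix.sub_mul, Matrix.mul_sub,
      Matrix.mul_assoc, hXX, hQQ, Matrix.one_mul, Matrix.mul_one]
    abel
  refine ⟨⟨_, hW⟩, ?_⟩
  simp only [Matrix.mul_add, Matrix.mul_sub, Matrix.mul_assoc, hXX, Matrix.mul_one, sub_self,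
    add_zero]

/-- The squared length of the projection of `e_{k+1}` to `ker (Vᴴ X)`, as a function of `V`. The
value is meaningful only where `Xᴴ V` has rank `k`, which is almost surely the case. -/
noncomputable def lastCoordSq (X : Fin (k + 1) → EuclideanSpace 𝕜 (Fin n))
    (V : Matrix (Fin n) (Fin k) 𝕜) : ℝ :=
  ‖residualVec ((colMatrix X)ᴴ * V) (EuclideanSpace.single (Fin.last k) 1)‖ ^ 2

theorem measurable_norm_residual (X : Fin (k + 1) → EuclideanSpace 𝕜 (Fin n)) :
    Measurable fun p : Matrix (Fin n) (Fin k) 𝕜 × EuclideanSpace 𝕜 (Fin (k + 1)) =>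
      ‖residualVec ((colMatrix X)ᴴ * p.1) p.2‖ := by
  refine (measurable_residual.comp (Measurable.prodMk ?_ measurable_snd)).norm
  exact (Continuous.measurable (f := fun V : Matrix (Fin n) (Fin k) 𝕜 => (colMatrix X)ᴴ * V)
    (by fun_prop)).comp measurable_fst

theorem measurable_lastCoordSq (X : Fin (k + 1) → EuclideanSpace 𝕜 (Fin n)) :
    Measurable (lastCoordSq X) :=
  ((measurable_norm_residual X).comp (Measurable.prodMk measurable_id measurable_const)).pow_const 2

/-- The moments of the residual of `w` do not change when `w` is rotated, because the law of
`Xᴴ V` is invariant under unitary matrices. -/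
theorem lintegral_residual_unitary {X : Fin (k + 1) → EuclideanSpace 𝕜 (Fin n)}
    (hX : Orthonormal 𝕜 X) (Q : unitaryGroup (Fin (k + 1)) 𝕜) (m : ℕ)
    (w : EuclideanSpace 𝕜 (Fin (k + 1))) :
    ∫⁻ V, ENNReal.ofReal (‖residualVec ((colMatrix X)ᴴ * V) (toEuclideanLin Q.val w)‖ ^ (2 * m))
        ∂stiefelUniform 𝕜 n k =
      ∫⁻ V, ENNReal.ofReal (‖residualVec ((colMatrix X)ᴴ * V) w‖ ^ (2 * m))
        ∂stiefelUniform 𝕜 n k := by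
  have hQ : (Q.val)ᴴ * Q.val = 1 := mem_unitaryGroup_iff'.mp Q.2
  obtain ⟨W, hW⟩ := exists_unitary_conjTranspose_mul (colMatrix_isometry hX) Q
  have hmeas : Measurable fun V : Matrix (Fin n) (Fin k) 𝕜 => ENNReal.ofReal
      (‖residualVec ((colMatrix X)ᴴ * V) (toEuclideanLin Q.val w)‖ ^ (2 * m)) :=
    (((measurable_norm_residual X).comp
      (Measurable.prodMk measurable_id measurable_const)).pow_const _).ennreal_ofReal
  conv_lhs => rw [← map_mul_stiefelUniform W]
  rw [lintegral_map hmeas (Continuous.measurable (by fun_prop))]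
  refine lintegral_congr fun V => ?_
  rw [← Matrix.mul_assoc, hW, Matrix.mul_assoc, residual_mul hQ, norm_toEuclideanLin hQ]

theorem lintegral_residual {X : Fin (k + 1) → EuclideanSpace 𝕜 (Fin n)}
    (hX : Orthonormal 𝕜 X) (m : ℕ) (w : EuclideanSpace 𝕜 (Fin (k + 1))) :
    ∫⁻ V, ENNReal.ofReal (‖residualVec ((colMatrix X)ᴴ * V) w‖ ^ (2 * m)) ∂stiefelUniform 𝕜 n k =
      ENNReal.ofReal (‖w‖ ^ (2 * m)) *
        ∫⁻ V, ENNReal.ofReal (lastCoordSq X V ^ m) ∂stiefelUniform 𝕜 n k := by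
  have he : ‖(EuclideanSpace.single (Fin.last k) 1 : EuclideanSpace 𝕜 (Fin (k + 1)))‖ = 1 := by
    simp
  obtain ⟨Q, hQ⟩ : ∃ Q : unitaryGroup (Fin (k + 1)) 𝕜, w =
      ((‖w‖ : ℝ) : 𝕜) • toEuclideanLin Q.val (EuclideanSpace.single (Fin.last k) 1) := by
    by_cases hw : w = 0
    · exact ⟨1, by simp [hw]⟩
    · obtain ⟨Q, hQ⟩ := exists_unitary_apply_eq (by omega) he
        (v := ((‖w‖⁻¹ : ℝ) : 𝕜) • w) (by
          rw [norm_smul, RCLike.norm_ofReal, abs_of_nonneg (by positivity),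
            inv_mul_cancel₀ (norm_ne_zero_iff.mpr hw)])
      refine ⟨Q, ?_⟩
      rw [hQ, smul_smul, ← RCLike.ofReal_mul, mul_inv_cancel₀ (norm_ne_zero_iff.mpr hw),
        RCLike.ofReal_one, one_smul]
  have hstep : ∀ V : Matrix (Fin n) (Fin k) 𝕜,
      ENNReal.ofReal (‖residualVec ((colMatrix X)ᴴ * V) w‖ ^ (2 * m)) =
      ENNReal.ofReal (‖w‖ ^ (2 * m)) * ENNReal.ofReal (‖residualVec ((colMatrix X)ᴴ * V)
        (toEuclideanLin Q.val (EuclideanSpace.single (Fin.last k) 1))‖ ^ (2 * m)) := by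
    intro V
    rw [← ENNReal.ofReal_mul (by positivity), ← mul_pow]
    conv_lhs => rw [hQ, residual_smul, norm_smul, RCLike.norm_ofReal, abs_norm]
  simp_rw [hstep]
  rw [lintegral_const_mul', lintegral_residual_unitary hX]
  · simp_rw [lastCoordSq, ← pow_mul]
  · exact ENNReal.ofReal_ne_top

/-- `Xᴴ V` has rank `k` almost surely. -/
theorem ae_det_ne_zero (hkn : k ≤ n) {X : Fin (k + 1) → EuclideanSpace 𝕜 (Fin n)}
    (hX : Orthonormal 𝕜 X) : ∀ᵐ V ∂stiefelUniform 𝕜 n k,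
      (((colMatrix X)ᴴ * V)ᴴ * ((colMatrix X)ᴴ * V)).det ≠ 0 := by
  let X₁ : Matrix (Fin n) (Fin k) 𝕜 := colMatrix fun j : Fin k => X j.castSucc
  have hX₁ : X₁ᴴ * X₁ = 1 := colMatrix_isometry (hX.comp _ (Fin.castSucc_injective k))
  filter_upwards [ae_stiefelUniform_det_ne_zero hkn hX₁] with V hV h0
  obtain ⟨v, hv, hv0⟩ := exists_mulVec_eq_zero_iff.mpr h0
  have h1 : ((colMatrix X)ᴴ * V) *ᵥ v = 0 := by
    open scoped ComplexOrder in
    exact (conjTranspose_mul_self_mulVec_eq_zero _ _).mp hv0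
  refine hV ?_
  rw [← star_eq_zero, ← det_conjTranspose, conjTranspose_mul, conjTranspose_conjTranspose]
  refine exists_mulVec_eq_zero_iff.mp ⟨v, hv, ?_⟩
  ext i
  exact congrFun h1 i.castSucc

/-- The Gaussian moment of the coordinate along a unit vector does not depend on the vector. -/
theorem lintegral_inner_pow_mul_exp {a : EuclideanSpace 𝕜 (Fin (k + 1))} (ha : ‖a‖ = 1) (m : ℕ) :
    ∫⁻ w, ENNReal.ofReal (‖(inner 𝕜 a w : 𝕜)‖ ^ (2 * m)) * ENNReal.ofReal (Real.exp (-‖w‖ ^ 2))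
        ∂euclideanHaar 𝕜 (k + 1) =
      ∫⁻ w, ENNReal.ofReal (‖w (Fin.last k)‖ ^ (2 * m) * Real.exp (-‖w‖ ^ 2))
        ∂euclideanHaar 𝕜 (k + 1) := by
  have he : ‖(EuclideanSpace.single (Fin.last k) 1 : EuclideanSpace 𝕜 (Fin (k + 1)))‖ = 1 := by
    simp
  obtain ⟨Q, hQ⟩ := exists_unitary_apply_eq (by omega) he ha
  have hQQ : (Q.val)ᴴ * Q.val = 1 := mem_unitaryGroup_iff'.mp Q.2
  -- rotate `w` so that `a` becomes the last basis vector
  let g : EuclideanSpace 𝕜 (Fin (k + 1)) ≃ₗᵢ[𝕜] EuclideanSpace 𝕜 (Fin (k + 1)) :=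
    LinearIsometry.toLinearIsometryEquiv ⟨toEuclideanLin Q.val, norm_toEuclideanLin hQQ⟩ rfl
  have hg : ∀ w, inner 𝕜 a (g w) = w (Fin.last k) := fun w => by
    change inner 𝕜 a (toEuclideanLin Q.val w) = _
    rw [← hQ, inner_toEuclideanLin_left Q.val, ← toEuclideanLin_mul, hQQ]
    simp [EuclideanSpace.inner_single_left]
  conv_lhs => rw [← map_linearIsometryEquiv_addHaar (euclideanHaar 𝕜 (k + 1)) g]
  have hge : MeasurableEmbedding g := g.toHomeomorph.measurableEmbedding
  rw [hge.lintegral_map]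
  refine lintegral_congr fun w => ?_
  rw [ENNReal.ofReal_mul (by positivity)]
  rw [hg, LinearIsometryEquiv.norm_map]

/-- The moments of `lastCoordSq`: integrate the moments of the residual of `w` against the Gaussian
function of `w`. For fixed `w`, they are a multiple of the moment in question, while for fixed `V`
the residual is the inner product with a unit vector. -/
theorem lintegral_lastCoordSq_pow (hk : 1 ≤ k) (hkn : k ≤ n)
    {X : Fin (k + 1) → EuclideanSpace 𝕜 (Fin n)} (hX : Orthonormal 𝕜 X) (m : ℕ) :
    ∫⁻ V, ENNReal.ofReal (lastCoordSq X V ^ m) ∂stiefelUniform 𝕜 n k =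
      ENNReal.ofReal (beta (phi 𝕜 / 2 + m) (phi 𝕜 * k / 2) /
        beta (phi 𝕜 / 2) (phi 𝕜 * k / 2)) := by
  set μ := euclideanHaar 𝕜 (k + 1)
  set M := ∫⁻ V, ENNReal.ofReal (lastCoordSq X V ^ m) ∂stiefelUniform 𝕜 n k
  set J := ∫ w, ‖w (Fin.last k)‖ ^ (2 * m) * Real.exp (-‖w‖ ^ 2) ∂μ with hJ
  set R := ∫ w, ‖w‖ ^ (2 * m) * Real.exp (-‖w‖ ^ 2) ∂μ with hR
  have hRpos : 0 < R := integral_norm_pow_mul_exp_pos μ m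
  have hratio : J / R = _ := integral_coord_div_integral_norm (𝕜 := 𝕜) hk m
  have hJpos : 0 < J := by
    rw [hJ, integral_coord_pow_mul_exp]
    have h0 := integral_norm_pow_mul_exp_pos (Measure.addHaar : Measure 𝕜) 0
    simp only [mul_zero, pow_zero, one_mul] at h0
    exact mul_pos (pow_pos h0 k) (integral_norm_pow_mul_exp_pos _ m)
  -- a Bochner integral with nonzero value certifies integrability
  have hJint : ENNReal.ofReal J =
      ∫⁻ w, ENNReal.ofReal (‖w (Fin.last k)‖ ^ (2 * m) * Real.exp (-‖w‖ ^ 2)) ∂μ :=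
    ofReal_integral_eq_lintegral_ofReal (not_imp_comm.mp integral_undef hJpos.ne')
      (Filter.Eventually.of_forall fun w => by positivity)
  have hRint : ENNReal.ofReal R =
      ∫⁻ w, ENNReal.ofReal (‖w‖ ^ (2 * m) * Real.exp (-‖w‖ ^ 2)) ∂μ :=
    ofReal_integral_eq_lintegral_ofReal (not_imp_comm.mp integral_undef hRpos.ne')
      (Filter.Eventually.of_forall fun w => by positivity)
  let f : Matrix (Fin n) (Fin k) 𝕜 → EuclideanSpace 𝕜 (Fin (k + 1)) → ENNReal := fun V w =>
    ENNReal.ofReal (‖residualVec ((colMatrix X)ᴴ * V) w‖ ^ (2 * m)) *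
      ENNReal.ofReal (Real.exp (-‖w‖ ^ 2))
  have hf : Measurable (Function.uncurry f) :=
    ((measurable_norm_residual X).pow_const _).ennreal_ofReal.mul
      (by fun_prop)
  have hswap := lintegral_lintegral_swap (μ := stiefelUniform 𝕜 n k) (ν := μ) hf.aemeasurable
  have hright : ∫⁻ w, ∫⁻ V, f V w ∂stiefelUniform 𝕜 n k ∂μ = ENNReal.ofReal R * M := by
    rw [hRint, ← lintegral_mul_const]
    · refine lintegral_congr fun w => ?_
      simp only [f]
      rw [lintegral_mul_const' _ _ ENNReal.ofReal_ne_top, lintegral_residual hX,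
        ENNReal.ofReal_mul (by positivity)]
      ring
    · fun_prop
  have hleft : ∫⁻ V, ∫⁻ w, f V w ∂μ ∂stiefelUniform 𝕜 n k = ENNReal.ofReal J := by
    have hae : ∀ᵐ V ∂stiefelUniform 𝕜 n k, ∫⁻ w, f V w ∂μ = ENNReal.ofReal J := by
      filter_upwards [ae_det_ne_zero hkn hX] with V hV
      obtain ⟨a, ha, hTa⟩ := exists_unit_mem_ker hV
      rw [hJint, ← lintegral_inner_pow_mul_exp ha m]
      refine lintegral_congr fun w => ?_
      rw [← norm_residual hV ha hTa]
    rw [lintegral_congr_ae hae]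
    simp
  rw [hleft, hright] at hswap
  rw [← hratio, ENNReal.ofReal_div_of_pos hRpos, hswap, mul_comm,
    ENNReal.mul_div_cancel_right (by simpa using hRpos) ENNReal.ofReal_ne_top]

theorem hasLaw_lastCoordSq (hk : 1 ≤ k) (hkn : k ≤ n)
    {X : Fin (k + 1) → EuclideanSpace 𝕜 (Fin n)} (hX : Orthonormal 𝕜 X) :
    HasLaw (lastCoordSq X) (betaMeasure (phi 𝕜 / 2) (phi 𝕜 * k / 2)) (stiefelUniform 𝕜 n k) := by
  have hφ : 0 < phi 𝕜 := phi_pos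
  have hk' : (0 : ℝ) < k := by exact_mod_cast hk
  have hmeas := measurable_lastCoordSq X
  refine ⟨hmeas.aemeasurable, ?_⟩
  have : IsProbabilityMeasure (betaMeasure (phi 𝕜 / 2) (phi 𝕜 * k / 2)) :=
    isProbabilityMeasureBeta (by positivity) (by positivity)
  have : IsProbabilityMeasure ((stiefelUniform 𝕜 n k).map (lastCoordSq X)) :=
    Measure.isProbabilityMeasure_map hmeas.aemeasurable
  refine ext_of_lintegral_pow ?_ (ae_betaMeasure_mem_Icc _ _) fun m => ?_
  · refine (ae_map_iff hmeas.aemeasurable measurableSet_Icc).mpr ?_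
    filter_upwards [ae_det_ne_zero hkn hX] with V hV
    obtain ⟨a, ha, hTa⟩ := exists_unit_mem_ker hV
    rw [lastCoordSq, norm_residual hV ha hTa]
    refine ⟨by positivity, pow_le_one₀ (norm_nonneg _) ?_⟩
    refine (norm_inner_le_norm _ _).trans ?_
    simp [ha]
  · rw [lintegral_map (by fun_prop) hmeas, lintegral_lastCoordSq_pow hk hkn hX,
      lintegral_pow_betaMeasure (by positivity) (by positivity)]

/-- If `X a` is a unit vector in `ker Vᴴ`, then `lastCoordSq` is the squared modulus of the last
coordinate of `a`. -/
theorem norm_last_sq_eq_lastCoordSq {X : Fin (k + 1) → EuclideanSpace 𝕜 (Fin n)}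
    (hX : Orthonormal 𝕜 X) {V : Matrix (Fin n) (Fin k) 𝕜}
    (hV : (((colMatrix X)ᴴ * V)ᴴ * ((colMatrix X)ᴴ * V)).det ≠ 0) {a : Fin (k + 1) → 𝕜}
    (ha : ‖∑ j, a j • X j‖ = 1) (hVa : toEuclideanLin Vᴴ (∑ j, a j • X j) = 0) :
    ‖a (Fin.last k)‖ ^ 2 = lastCoordSq X V := by
  have hsum := toEuclideanLin_colMatrix X (WithLp.toLp 2 a)
  simp only at hsum
  rw [← hsum] at ha hVa
  rw [norm_toEuclideanLin (colMatrix_isometry hX)] at ha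
  rw [← toEuclideanLin_mul] at hVa
  rw [lastCoordSq, norm_residual hV ha (by
    rwa [conjTranspose_mul, conjTranspose_conjTranspose]), EuclideanSpace.inner_single_right]
  simp

end Law

/-! ### The rank-completed pencil -/

section RankCompletion

variable {𝕜 : Type*} [RCLike 𝕜] {n k : ℕ}

theorem rankCompleted_sub_smul (A B : Matrix (Fin n) (Fin n) 𝕜) (τ lam : 𝕜)
    (U V : Matrix (Fin n) (Fin k) 𝕜) (dA dB : Fin k → 𝕜) :
    rankCompleted A τ U V dA - lam • rankCompleted B τ U V dB =
      (A - lam • B) + U * diagonal (fun j => τ * (dA j - lam * dB j)) * Vᴴ := by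
  have h : diagonal (fun j => τ * (dA j - lam * dB j)) =
      τ • (diagonal dA - lam • diagonal dB : Matrix (Fin k) (Fin k) 𝕜) := by
    ext i j
    by_cases hij : i = j <;> simp [hij]
  rw [h, rankCompleted, rankCompleted, Matrix.mul_smul, Matrix.smul_mul, Matrix.mul_sub,
    Matrix.sub_mul, Matrix.mul_smul, Matrix.smul_mul, smul_add, smul_sub, smul_comm lam τ]
  abel

theorem isUnit_diagonal_smul {τ : 𝕜} (hτ : τ ≠ 0) {d : Fin k → 𝕜} (hd : ∀ j, d j ≠ 0) :
    IsUnit (diagonal fun j => τ * d j) := by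
  rw [isUnit_iff_isUnit_det, det_diagonal, isUnit_iff_ne_zero, Finset.prod_ne_zero_iff]
  exact fun j _ => mul_ne_zero hτ (hd j)

theorem eval_det_pencil (A B : Matrix (Fin n) (Fin n) 𝕜) (μ : 𝕜) :
    (pencil A B).det.eval μ = (A - μ • B).det := by
  rw [← Polynomial.coe_evalRingHom, RingHom.map_det]
  congr 1
  ext i j
  simpa [pencil] using mul_comm _ _

theorem det_ne_zero_of_forall {C : Matrix (Fin n) (Fin n) 𝕜}
    (h : ∀ z, toEuclideanLin C z = 0 → z = 0) : C.det ≠ 0 := by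
  intro h0
  obtain ⟨v, hv, hv0⟩ := exists_mulVec_eq_zero_iff.mpr h0
  refine hv ?_
  have := h (WithLp.toLp 2 v) (by simp [toLpLin_apply, hv0])
  simpa using this

/-- If `C + U Vᴴ` is invertible, then the kernel of `C` meets `ker Vᴴ` trivially, and hence has
dimension at most `k`. -/
theorem finrank_ker_le_of_det_ne_zero {C : Matrix (Fin n) (Fin n) 𝕜}
    {U V : Matrix (Fin n) (Fin k) 𝕜} (h : (C + U * Vᴴ).det ≠ 0) :
    finrank 𝕜 (LinearMap.ker (toEuclideanLin C)) ≤ k ∧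
      ∀ z, toEuclideanLin C z = 0 → toEuclideanLin Vᴴ z = 0 → z = 0 := by
  have h2 : ∀ z, toEuclideanLin C z = 0 → toEuclideanLin Vᴴ z = 0 → z = 0 := by
    intro z hz hVz
    refine eq_zero_of_det_ne_zero h ?_
    rw [map_add, LinearMap.add_apply, toEuclideanLin_mul, hz, hVz, map_zero, add_zero]
  refine ⟨?_, h2⟩
  have hker := finrank_map_add_finrank_inf_ker (toEuclideanLin Vᴴ)
    (LinearMap.ker (toEuclideanLin C))
  have hbot : LinearMap.ker (toEuclideanLin C) ⊓ LinearMap.ker (toEuclideanLin Vᴴ) = ⊥ :=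
    (Submodule.eq_bot_iff _).mpr fun y hy => h2 y hy.1 hy.2
  have hle := Submodule.finrank_le ((LinearMap.ker (toEuclideanLin C)).map (toEuclideanLin Vᴴ))
  rw [finrank_euclideanSpace_fin] at hle
  rw [hbot, finrank_bot, add_zero] at hker
  omega

open scoped ComplexOrder in
theorem finrank_ker_conjTranspose_eq (C : Matrix (Fin n) (Fin n) 𝕜) :
    finrank 𝕜 (LinearMap.ker (toEuclideanLin Cᴴ)) =
      finrank 𝕜 (LinearMap.ker (toEuclideanLin C)) := by
  have h1 := rank_add_finrank_ker C
  have h2 := rank_add_finrank_ker Cᴴ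
  rw [rank_conjTranspose] at h2
  omega

theorem det_ne_zero_conjTranspose {C : Matrix (Fin n) (Fin n) 𝕜} {U V : Matrix (Fin n) (Fin k) 𝕜}
    (h : (C + U * Vᴴ).det ≠ 0) : (Cᴴ + V * Uᴴ).det ≠ 0 := by
  have : Cᴴ + V * Uᴴ = (C + U * Vᴴ)ᴴ := by
    rw [conjTranspose_add, conjTranspose_mul, conjTranspose_conjTranspose]
  rwa [this, det_conjTranspose, Ne, star_eq_zero]

/-- If `A - μ₀ B + U Vᴴ` is invertible for a single `μ₀`, then the rank-completed pencil is
regular: at all but finitely many `μ`, both `A - μ B + U Vᴴ` and the diagonal factor are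
invertible. -/
theorem det_pencil_rankCompleted_ne_zero {A B : Matrix (Fin n) (Fin n) 𝕜}
    (hrank : nrank A B + k = n) {U V : Matrix (Fin n) (Fin k) 𝕜} {μ₀ lam τ : 𝕜} (hτ : τ ≠ 0)
    {dA dB : Fin k → 𝕜} (hd : ∀ j, dA j - lam * dB j ≠ 0)
    (h : ((A - μ₀ • B) + U * Vᴴ).det ≠ 0) :
    (pencil (rankCompleted A τ U V dA) (rankCompleted B τ U V dB)).det ≠ 0 := by
  have hsub : ∀ μ : 𝕜, A + U * Vᴴ - μ • B = (A - μ • B) + U * Vᴴ := fun μ => by abel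
  have hp : (pencil (A + U * Vᴴ) B).det ≠ 0 := by
    intro h0
    refine h ?_
    rw [← hsub, ← eval_det_pencil, h0, Polynomial.eval_zero]
  have hq : (∏ j, (Polynomial.C (dA j) - Polynomial.X * Polynomial.C (dB j)) :
      Polynomial 𝕜) ≠ 0 := by
    intro h0
    have := congrArg (Polynomial.eval lam) h0
    rw [Polynomial.eval_prod, Polynomial.eval_zero, Finset.prod_eq_zero_iff] at this
    obtain ⟨j, -, hj⟩ := this
    exact hd j (by rw [mul_comm lam]; simpa using hj)
  obtain ⟨μ, hμ⟩ : ∃ μ : 𝕜, ((pencil (A + U * Vᴴ) B).det *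
      ∏ j, (Polynomial.C (dA j) - Polynomial.X * Polynomial.C (dB j))).eval μ ≠ 0 := by
    by_contra! hall
    exact mul_ne_zero hp hq (Polynomial.funext fun μ => by rw [hall, Polynomial.eval_zero])
  rw [Polynomial.eval_mul, eval_det_pencil, hsub, Polynomial.eval_prod] at hμ
  have hμ1 := left_ne_zero_of_mul hμ
  have hμ2 : ∀ j, dA j - μ * dB j ≠ 0 := fun j => by
    rw [mul_comm μ]
    simpa using Finset.prod_ne_zero_iff.mp (right_ne_zero_of_mul hμ) j (Finset.mem_univ j)
  -- the kernels at `μ` have dimension exactly `k`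
  have hV := finrank_ker_le_of_det_ne_zero hμ1
  have hU := finrank_ker_le_of_det_ne_zero (det_ne_zero_conjTranspose hμ1)
  have hr := rank_add_finrank_ker (A - μ • B)
  have hr' := rank_le_nrank A B μ
  have hdim := finrank_ker_conjTranspose_eq (A - μ • B)
  intro h0
  have h1 : (rankCompleted A τ U V dA - μ • rankCompleted B τ U V dB).det = 0 := by
    rw [← eval_det_pencil, h0, Polynomial.eval_zero]
  refine det_ne_zero_of_forall (fun z hz => ?_) h1
  rw [rankCompleted_sub_smul] at hz
  obtain ⟨hVz, hCz⟩ := ker_add_mul_mul (isUnit_diagonal_smul hτ hμ2)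
    (S := LinearMap.ker (toEuclideanLin (A - μ • B)ᴴ)) (by omega) (fun y hy => hy) hU.2 hz
  exact hV.2 z hCz hVz

theorem ae_stiefelUniform_ker_conjTranspose (C : Matrix (Fin n) (Fin n) 𝕜) (hC : C.rank + k = n) :
    ∀ᵐ U ∂stiefelUniform 𝕜 n k, ∀ y ∈ LinearMap.ker (toEuclideanLin Cᴴ),
      toEuclideanLin Uᴴ y = 0 → y = 0 := by
  refine ae_stiefelUniform_ker_inf (by omega) ?_
  have := rank_add_finrank_ker C
  rw [finrank_ker_conjTranspose_eq]
  omega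

/-- Generic `U`, `V` complete a matrix of rank `n - k` to an invertible one. -/
theorem det_add_mul_conjTranspose_ne_zero {C : Matrix (Fin n) (Fin n) 𝕜} (hC : C.rank + k = n)
    {U V : Matrix (Fin n) (Fin k) 𝕜}
    (hU : ∀ y ∈ LinearMap.ker (toEuclideanLin Cᴴ), toEuclideanLin Uᴴ y = 0 → y = 0)
    (hV : ∀ z ∈ LinearMap.ker (toEuclideanLin C), toEuclideanLin Vᴴ z = 0 → z = 0) :
    (C + U * Vᴴ).det ≠ 0 := by
  have hr := rank_add_finrank_ker C
  have hdim := finrank_ker_conjTranspose_eq C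
  refine det_ne_zero_of_forall fun z hz => ?_
  obtain ⟨hVz, hCz⟩ := ker_add_mul_mul (C := C) (U := U) (V := V) isUnit_one
    (S := LinearMap.ker (toEuclideanLin Cᴴ)) (by omega) (fun y hy => hy) hU
    (by rwa [Matrix.mul_one])
  exact hV z hCz hVz

theorem IsDistinguishedBasis.existsUnique_coeff {A B : Matrix (Fin n) (Fin n) 𝕜} {lam : 𝕜}
    {X : Fin (k + 1) → EuclideanSpace 𝕜 (Fin n)} (hX : IsDistinguishedBasis k A B lam X)
    {z : EuclideanSpace 𝕜 (Fin n)} (hz : toEuclideanLin (A - lam • B) z = 0) :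
    ∃! a : Fin (k + 1) → 𝕜, z = ∑ j, a j • X j := by
  have hmem : z ∈ Submodule.span 𝕜 (Set.range X) := by rw [hX.span_eq]; exact hz
  obtain ⟨a, ha⟩ := (Submodule.mem_span_range_iff_exists_fun 𝕜).mp hmem
  refine ⟨a, ha.symm, fun b hb => ?_⟩
  have hli : LinearIndependent 𝕜 X := hX.orthonormal.linearIndependent
  have := hb.symm.trans ha.symm
  have h0 : ∑ j, (b j - a j) • X j = 0 := by
    simp only [sub_smul, Finset.sum_sub_distrib]
    rw [this, sub_self]
  ext j
  exact sub_eq_zero.mp (Fintype.linearIndependent_iff.mp hli _ h0 j)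

theorem IsDistinguishedBasis.finrank_span_init {A B : Matrix (Fin n) (Fin n) 𝕜} {lam : 𝕜}
    {X : Fin (k + 1) → EuclideanSpace 𝕜 (Fin n)} (hX : IsDistinguishedBasis k A B lam X) :
    finrank 𝕜 (Submodule.span 𝕜 (Set.range fun j : Fin k => X j.castSucc)) = k := by
  rw [finrank_span_eq_card (b := fun j : Fin k => X j.castSucc)
    (hX.orthonormal.linearIndependent.comp _ (Fin.castSucc_injective k)), Fintype.card_fin]

theorem IsDistinguishedBasis.finrank_pencilKer {A B : Matrix (Fin n) (Fin n) 𝕜} {lam : 𝕜}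
    {X : Fin (k + 1) → EuclideanSpace 𝕜 (Fin n)} (hX : IsDistinguishedBasis k A B lam X) :
    finrank 𝕜 (pencilKer A B lam) = k + 1 := by
  rw [← hX.span_eq, finrank_span_eq_card hX.orthonormal.linearIndependent, Fintype.card_fin]

theorem IsDistinguishedBasis.span_init_le {A B : Matrix (Fin n) (Fin n) 𝕜} {lam : 𝕜}
    {X : Fin (k + 1) → EuclideanSpace 𝕜 (Fin n)} (hX : IsDistinguishedBasis k A B lam X) :
    Submodule.span 𝕜 (Set.range fun j : Fin k => X j.castSucc) ≤ pencilKer A B lam :=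
  hX.span_init_eq ▸ inf_le_left

/-- If `Uᴴ` and `Vᴴ` are injective on the spans of `Y₁` and `X₁`, then the null vectors of
`A - lam B + U D Vᴴ` are the vectors of `ker (A - lam B) ∩ ker Vᴴ`, which is at most a line. -/
theorem IsDistinguishedBasis.finrank_ker_le_one {A B : Matrix (Fin n) (Fin n) 𝕜} {lam : 𝕜}
    {X Y : Fin (k + 1) → EuclideanSpace 𝕜 (Fin n)} (hX : IsDistinguishedBasis k A B lam X)
    (hY : IsDistinguishedBasis k Aᴴ Bᴴ (star lam) Y) {U V : Matrix (Fin n) (Fin k) 𝕜}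
    (hU : ∀ y ∈ Submodule.span 𝕜 (Set.range fun j : Fin k => Y j.castSucc),
      toEuclideanLin Uᴴ y = 0 → y = 0)
    (hV : ∀ z ∈ Submodule.span 𝕜 (Set.range fun j : Fin k => X j.castSucc),
      toEuclideanLin Vᴴ z = 0 → z = 0)
    {D : Matrix (Fin k) (Fin k) 𝕜} (hD : IsUnit D) :
    (∀ z, toEuclideanLin (A - lam • B + U * D * Vᴴ) z = 0 →
      toEuclideanLin Vᴴ z = 0 ∧ toEuclideanLin (A - lam • B) z = 0) ∧
    finrank 𝕜 (LinearMap.ker (toEuclideanLin (A - lam • B + U * D * Vᴴ))) ≤ 1 := by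
  have hker : ∀ z, toEuclideanLin (A - lam • B + U * D * Vᴴ) z = 0 →
      toEuclideanLin Vᴴ z = 0 ∧ toEuclideanLin (A - lam • B) z = 0 := fun z hz =>
    ker_add_mul_mul hD hY.finrank_span_init
      (fun y hy => by rw [conjTranspose_sub_smul]; exact hY.span_init_le hy) hU hz
  refine ⟨hker, ?_⟩
  set L := LinearMap.ker (toEuclideanLin (A - lam • B + U * D * Vᴴ))
  set S := Submodule.span 𝕜 (Set.range fun j : Fin k => X j.castSucc)
  have hsum := Submodule.finrank_sup_add_finrank_inf_eq L S
  have hinf : L ⊓ S = ⊥ := (Submodule.eq_bot_iff _).mpr fun z hz => hV z hz.2 (hker z hz.1).1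
  have hsup : L ⊔ S ≤ pencilKer A B lam := sup_le (fun z hz => (hker z hz).2) hX.span_init_le
  have hle := Submodule.finrank_mono (R := 𝕜) hsup
  have hS : finrank 𝕜 S = k := hX.finrank_span_init
  rw [hX.finrank_pencilKer] at hle
  rw [hinf, finrank_bot] at hsum
  omega

theorem finrank_ker_eq_one_of_le {C : Matrix (Fin n) (Fin n) 𝕜}
    (h : finrank 𝕜 (LinearMap.ker (toEuclideanLin C)) ≤ 1) {z : EuclideanSpace 𝕜 (Fin n)}
    (hz : ‖z‖ = 1) (hCz : toEuclideanLin C z = 0) :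
    finrank 𝕜 (LinearMap.ker (toEuclideanLin C)) = 1 := by
  refine le_antisymm h (Nat.one_le_iff_ne_zero.mpr fun h0 => ?_)
  rw [Submodule.finrank_eq_zero] at h0
  have : z ∈ LinearMap.ker (toEuclideanLin C) := hCz
  rw [h0, Submodule.mem_bot] at this
  simp [this] at hz

theorem conjTranspose_add_mul_diagonal_mul (C : Matrix (Fin n) (Fin n) 𝕜)
    (U V : Matrix (Fin n) (Fin k) 𝕜) (D : Matrix (Fin k) (Fin k) 𝕜) :
    (C + U * D * Vᴴ)ᴴ = Cᴴ + V * Dᴴ * Uᴴ := by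
  simp [Matrix.mul_assoc]

end RankCompletion

theorem proposition4p4 {𝕜 : Type*} [RCLike 𝕜] {n k : ℕ} (hk : 1 ≤ k)
    -- a singular pencil of normal rank `n - k` with a finite simple eigenvalue `lam`
    (A B : Matrix (Fin n) (Fin n) 𝕜) (hrank : nrank A B + k = n)
    (lam : 𝕜) (hlam : IsSimpleEigenvalue A B lam)
    -- the distinguished orthonormal bases `[X₁ x]` and `[Y₁ y]`
    (X Y : Fin (k + 1) → EuclideanSpace 𝕜 (Fin n))
    (hX : IsDistinguishedBasis k A B lam X)
    (hY : IsDistinguishedBasis k A.conjTranspose B.conjTranspose (star lam) Y)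
    -- independent uniform `U`, `V`
    {Ω : Type*} [MeasurableSpace Ω] (P : MeasureTheory.Measure Ω)
    [MeasureTheory.IsProbabilityMeasure P]
    (U V : Ω → Matrix (Fin n) (Fin k) 𝕜)
    (hU : ProbabilityTheory.HasLaw U (stiefelUniform 𝕜 n k) P)
    (hV : ProbabilityTheory.HasLaw V (stiefelUniform 𝕜 n k) P)
    (hUV : ProbabilityTheory.IndepFun U V P)
    -- `τ ≠ 0` and diagonal matrices (fixed or random) such that `lam` is not a prescribed eigenvalue
    (τ : 𝕜) (hτ : τ ≠ 0) (dA dB : Ω → Fin k → 𝕜)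
    (hD : ∀ᵐ ω ∂P, ∀ j, dA ω j - lam * dB ω j ≠ 0)
    -- normalized right and left eigenvectors of the modified pencil for `lam`
    (xi yi : Ω → EuclideanSpace 𝕜 (Fin n))
    (hxi : ∀ᵐ ω ∂P, ‖xi ω‖ = 1 ∧
      Matrix.toEuclideanLin (rankCompleted A τ (U ω) (V ω) (dA ω) -
        lam • rankCompleted B τ (U ω) (V ω) (dB ω)) (xi ω) = 0)
    (hyi : ∀ᵐ ω ∂P, ‖yi ω‖ = 1 ∧
      Matrix.toEuclideanLin (rankCompleted A τ (U ω) (V ω) (dA ω) -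
        lam • rankCompleted B τ (U ω) (V ω) (dB ω)).conjTranspose (yi ω) = 0) :
    -- almost surely, the modified pencil is regular, its eigenvectors for `lam` are unique up to
    -- scalars, and `xi = [X₁ x] [a; α]`, `yi = [Y₁ y] [b; β]`, `Vᴴ xi = 0`, `Uᴴ yi = 0`
    (∀ᵐ ω ∂P,
      (pencil (rankCompleted A τ (U ω) (V ω) (dA ω))
        (rankCompleted B τ (U ω) (V ω) (dB ω))).det ≠ 0 ∧
      Module.finrank 𝕜 (pencilKer (rankCompleted A τ (U ω) (V ω) (dA ω))
        (rankCompleted B τ (U ω) (V ω) (dB ω)) lam) = 1 ∧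
      Module.finrank 𝕜 (pencilKer (rankCompleted A τ (U ω) (V ω) (dA ω)).conjTranspose
        (rankCompleted B τ (U ω) (V ω) (dB ω)).conjTranspose (star lam)) = 1 ∧
      Matrix.toEuclideanLin (V ω).conjTranspose (xi ω) = 0 ∧
      Matrix.toEuclideanLin (U ω).conjTranspose (yi ω) = 0 ∧
      (∃! a : Fin (k + 1) → 𝕜, xi ω = ∑ j, a j • X j) ∧
      (∃! b : Fin (k + 1) → 𝕜, yi ω = ∑ j, b j • Y j)) ∧
    -- `α` and `β` are the last coefficients
    ∀ a b : Ω → Fin (k + 1) → 𝕜,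
      (∀ᵐ ω ∂P, xi ω = ∑ j, a ω j • X j ∧ yi ω = ∑ j, b ω j • Y j) →
      ProbabilityTheory.IndepFun (fun ω => ‖a ω (Fin.last k)‖) (fun ω => ‖b ω (Fin.last k)‖) P ∧
      ProbabilityTheory.HasLaw (fun ω => ‖a ω (Fin.last k)‖ ^ 2)
        (ProbabilityTheory.betaMeasure (phi 𝕜 / 2) (phi 𝕜 * k / 2)) P ∧
      ProbabilityTheory.HasLaw (fun ω => ‖b ω (Fin.last k)‖ ^ 2)
        (ProbabilityTheory.betaMeasure (phi 𝕜 / 2) (phi 𝕜 * k / 2)) P ∧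
      ∀ᵐ ω ∂P, gammaVal B lam (yi ω) (xi ω) =
        ‖a ω (Fin.last k)‖ * ‖b ω (Fin.last k)‖ *
          gammaVal B lam (Y (Fin.last k)) (X (Fin.last k)) := by
  have hkn : k ≤ n := by omega
  obtain ⟨μ₀, hμ₀⟩ := exists_rank_eq_nrank A B
  have hC₀ : (A - μ₀ • B).rank + k = n := by rw [hμ₀, hrank]
  have hC₀' := rank_add_finrank_ker (A - μ₀ • B)
  -- transfer of almost sure properties from the Stiefel manifold to `Ω`
  have aeU : ∀ {p : Matrix (Fin n) (Fin k) 𝕜 → Prop}, (∀ᵐ W ∂stiefelUniform 𝕜 n k, p W) →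
      ∀ᵐ ω ∂P, p (U ω) := fun h => ae_of_ae_map hU.aemeasurable (by rwa [hU.map_eq])
  have aeV : ∀ {p : Matrix (Fin n) (Fin k) 𝕜 → Prop}, (∀ᵐ W ∂stiefelUniform 𝕜 n k, p W) →
      ∀ᵐ ω ∂P, p (V ω) := fun h => ae_of_ae_map hV.aemeasurable (by rwa [hV.map_eq])
  have hU₀ := aeU (ae_stiefelUniform_ker_conjTranspose (A - μ₀ • B) hC₀)
  have hV₀ := aeV (ae_stiefelUniform_ker_inf hkn
    (S := LinearMap.ker (toEuclideanLin (A - μ₀ • B))) (by omega))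
  have hUY := aeU (ae_stiefelUniform_ker_inf hkn hY.finrank_span_init)
  have hVX := aeV (ae_stiefelUniform_ker_inf hkn hX.finrank_span_init)
  have hUdet := aeU (ae_det_ne_zero hkn hY.orthonormal)
  have hVdet := aeV (ae_det_ne_zero hkn hX.orthonormal)
  have hmain : ∀ᵐ ω ∂P,
      (pencil (rankCompleted A τ (U ω) (V ω) (dA ω))
        (rankCompleted B τ (U ω) (V ω) (dB ω))).det ≠ 0 ∧
      finrank 𝕜 (pencilKer (rankCompleted A τ (U ω) (V ω) (dA ω))
        (rankCompleted B τ (U ω) (V ω) (dB ω)) lam) = 1 ∧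
      finrank 𝕜 (pencilKer (rankCompleted A τ (U ω) (V ω) (dA ω))ᴴ
        (rankCompleted B τ (U ω) (V ω) (dB ω))ᴴ (star lam)) = 1 ∧
      toEuclideanLin (V ω)ᴴ (xi ω) = 0 ∧ toEuclideanLin (U ω)ᴴ (yi ω) = 0 ∧
      (∃! a : Fin (k + 1) → 𝕜, xi ω = ∑ j, a j • X j) ∧
      (∃! b : Fin (k + 1) → 𝕜, yi ω = ∑ j, b j • Y j) := by
    filter_upwards [hD, hxi, hyi, hU₀, hV₀, hUY, hVX] with ω hDω hxω hyω hU₀ω hV₀ω hUω hVω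
    have hunit := isUnit_diagonal_smul hτ hDω
    have hunit' : IsUnit (diagonal fun j => τ * (dA ω j - lam * dB ω j))ᴴ := by
      rw [isUnit_iff_isUnit_det, det_conjTranspose, isUnit_iff_ne_zero, Ne, star_eq_zero,
        ← Ne, ← isUnit_iff_ne_zero, ← isUnit_iff_isUnit_det]
      exact hunit
    obtain ⟨hxn, hx⟩ := hxω
    obtain ⟨hyn, hy⟩ := hyω
    have hright := hX.finrank_ker_le_one hY hUω hVω hunit
    have hX' : IsDistinguishedBasis k Aᴴᴴ Bᴴᴴ (star (star lam)) X := by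
      rwa [conjTranspose_conjTranspose, conjTranspose_conjTranspose, star_star]
    have hleft := hY.finrank_ker_le_one hX' hVω hUω hunit'
    rw [← conjTranspose_sub_smul, ← conjTranspose_add_mul_diagonal_mul,
      ← rankCompleted_sub_smul] at hleft
    rw [← rankCompleted_sub_smul] at hright
    refine ⟨det_pencil_rankCompleted_ne_zero hrank hτ hDω
        (det_add_mul_conjTranspose_ne_zero hC₀ hU₀ω hV₀ω),
      finrank_ker_eq_one_of_le hright.2 hxn hx, ?_, (hright.1 _ hx).1, (hleft.1 _ hy).1,
      hX.existsUnique_coeff (hright.1 _ hx).2, hY.existsUnique_coeff ?_⟩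
    · rw [pencilKer, ← conjTranspose_sub_smul]
      exact finrank_ker_eq_one_of_le hleft.2 hyn hy
    · rw [← conjTranspose_sub_smul]
      exact (hleft.1 _ hy).2
  refine ⟨hmain, fun a b hab => ?_⟩
  -- `|α|²` and `|β|²` depend on `V` alone and on `U` alone, however the diagonal factor is chosen
  have haV : ∀ᵐ ω ∂P, lastCoordSq X (V ω) = ‖a ω (Fin.last k)‖ ^ 2 := by
    filter_upwards [hmain, hab, hVdet, hxi] with ω h1 h2 h3 h4
    refine (norm_last_sq_eq_lastCoordSq hX.orthonormal h3 ?_ ?_).symm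
    · rw [← h2.1]; exact h4.1
    · rw [← h2.1]; exact h1.2.2.2.1
  have hbU : ∀ᵐ ω ∂P, lastCoordSq Y (U ω) = ‖b ω (Fin.last k)‖ ^ 2 := by
    filter_upwards [hmain, hab, hUdet, hyi] with ω h1 h2 h3 h4
    refine (norm_last_sq_eq_lastCoordSq hY.orthonormal h3 ?_ ?_).symm
    · rw [← h2.2]; exact h4.1
    · rw [← h2.2]; exact h1.2.2.2.2.1
  refine ⟨?_, ?_, ?_, ?_⟩
  · have hind := hUV.symm.comp (measurable_lastCoordSq X).sqrt (measurable_lastCoordSq Y).sqrt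
    refine hind.congr ?_ ?_
    · filter_upwards [haV] with ω h
      simp only [Function.comp_apply]
      rw [h, Real.sqrt_sq (norm_nonneg _)]
    · filter_upwards [hbU] with ω h
      simp only [Function.comp_apply]
      rw [h, Real.sqrt_sq (norm_nonneg _)]
  · exact ((hasLaw_lastCoordSq hk hkn hX.orthonormal).comp hV).congr (haV.mono fun ω h => h.symm)
  · exact ((hasLaw_lastCoordSq hk hkn hY.orthonormal).comp hU).congr (hbU.mono fun ω h => h.symm)
  · filter_upwards [hab] with ω h
    rw [gammaVal, gammaVal, h.1, h.2, inner_sum_toEuclideanLin_sum hrank hX hY, norm_mul, norm_mul,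
      norm_star]
    ring
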